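/- Let $G$ be a countable discrete group and let $H \subseteq G$ be a subgroup. Let $\alpha$ be the action of $G$ on $C_0(G/H)$ by left translation, $\alpha_s(f)(x)=f(s^{-1}x)$. Let $A := C_0(G/H)\rtimes_\alpha G$ be the full crossed product, i.e. the enveloping $C^*$-algebra (the Hausdorff completion for the supremum of all $C^*$-seminorms) of the $*$-algebra $C_c(G,C_0(G/H))$ of finitely supported functions, with $f*g(s)=\sum_t f(t)\alpha_t(g(t^{-1}s))$ and $f^*(s)=\alpha_s(f(s^{-1})^*)$. Let $B := C^*(H)$ be the full group $C^*$-algebra, i.e. the enveloping $C^*$-algebra of the group $*$-algebra $\mathbb{C}[H]$, with canonical unitaries $v_t$ $(t\in H)$. An $A$-$B$ imprimitivity bimodule is a complex vector space $E$ with commuting left $A$- and right $B$-actions, an $A$-valued inner product (linear in the first variable, $A$-linear on the left, Hermitian, positive definite) and a $B$-valued inner product (linear in the second variable, $B$-linear on the right, Hermitian, positive definite) such that $\langle ax|y\rangle_B=\langle x|a^*y\rangle_B$, $\langle xb|y\rangle_A=\langle x|yb^*\rangle_A$, $\langle x|y\rangle_A z=x\langle y|z\rangle_B$, the inner products span dense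 subspaces of $A$ and of $B$, and $E$ is complete for each of the norms $\|\langle x|x\rangle_A\|^{1/2}$ and $\|\langle x|x\rangle_B\|^{1/2}$. Two $C^*$-algebras are Morita equivalent if such a bimodule exists. Then: 1. $C_0(G/H)\rtimes_\alpha G$ and $C^*(H)$ are Morita equivalent. 2. Let $A_0$ be the linear span of the elements $e_{rH}\otimes\delta_s$ $(r,s\in G)$, where $e_{rH}$ is the characteristic function of $\{rH\}$ and $a\otimes\delta_s$ is the function with value $a$ at $s$ and $0$ elsewhere; let $B_0=\mathbb{C}[H]$ be the span of $\{v_t : t \in H\}$, and $E_0=C_c(G)$ with its standard basis $\{\epsilon_t\}_{t\in G}$. The canonical maps embed $A_0$ and $B_0$ as dense $*$-subalgebras of $A$ and $B$. With the operations determined by $$(e_{rH}\otimes\delta_s)\cdot\epsilon_t=1_{rH}(st)\,\epsilon_{st},\quad \epsilon_t\cdot v_s=\epsilon_{ts},\quad \langle\epsilon_s|\epsilon_t\rangle_{A_0}=e_{sH}\otimes\delta_{st^{-1}},\quad \langle\epsilon_s|\epsilon_t\rangle_{B_0}=1_H(s^{-1}t)\,v_{s^{-1}t},$$ extended (conjugate-)linearly,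 $E_0$ is a pre $A_0$-$B_0$ imprimitivity bimodule: it is an $A_0$-$B_0$ bimodule, the two forms are $A_0$- resp. $B_0$-linear, Hermitian and positive semidefinite (in $A$ and in $B$), the three algebraic identities above hold, one has $\langle ax|ax\rangle_{B_0}\le\|a\|^2\langle x|x\rangle_{B_0}$ and $\langle xb|xb\rangle_{A_0}\le\|b\|^2\langle x|x\rangle_{A_0}$ for $a \in A_0$, $b \in B_0$, $x \in E_0$, and the values of the forms span dense subspaces of $A$ and $B$. 3. $E_0$ completes to an imprimitivity bimodule: there are an $A$-$B$ imprimitivity bimodule $E$ and a linear map $j:E_0\to E$ with dense range (for both norms of $E$) that intertwines the actions and preserves both inner products. -/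

import Mathlib

open scoped ZeroAtInfty

universe u

noncomputable section

/-! ### Enveloping C*-algebras -/

section Enveloping

/-- A `C*`-seminorm on a (not necessarily unital) complex `*`-algebra. -/
structure CStarSeminorm (R : Type*) [NonUnitalRing R] [StarRing R] [Module ℂ R]
    extends Seminorm ℂ R where
  star_mul_self' : ∀ x : R, toFun (star x * x) = toFun x ^ 2
  mul_le' : ∀ x y : R, toFun (x * y) ≤ toFun x * toFun y

variable {R : Type*} [NonUnitalRing R] [StarRing R] [Module ℂ R]

namespace CStarSeminorm

instance : CoeFun (CStarSeminorm R) (fun _ => R → ℝ) := ⟨fun p => p.toSeminorm⟩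

variable (p : CStarSeminorm R)

theorem star_mul_self (x : R) : p (star x * x) = p x ^ 2 := p.star_mul_self' x

theorem mul_le (x y : R) : p (x * y) ≤ p x * p y := p.mul_le' x y

theorem nonneg (x : R) : 0 ≤ p x := apply_nonneg p.toSeminorm x

theorem le_star (x : R) : p x ≤ p (star x) := by
  rcases (p.nonneg x).eq_or_lt with h | h
  · rw [← h]; exact p.nonneg _
  · have h1 : p x * p x ≤ p (star x) * p x := by
      have := p.mul_le (star x) x
      rwa [p.star_mul_self, sq] at this
    exact le_of_mul_le_mul_right h1 h

theorem star_eq (x : R) : p (star x) = p x :=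
  le_antisymm (by simpa using p.le_star (star x)) (p.le_star x)

/-- The algebra `R`, regarded as a seminormed space with the seminorm `p`. -/
def Pre (_ : CStarSeminorm R) : Type _ := R

instance : NonUnitalRing p.Pre := inferInstanceAs (NonUnitalRing R)
instance : StarRing p.Pre := inferInstanceAs (StarRing R)
instance : Module ℂ p.Pre := inferInstanceAs (Module ℂ R)
instance [IsScalarTower ℂ R R] : IsScalarTower ℂ p.Pre p.Pre :=
  inferInstanceAs (IsScalarTower ℂ R R)
instance [SMulCommClass ℂ R R] : SMulCommClass ℂ p.Pre p.Pre :=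
  inferInstanceAs (SMulCommClass ℂ R R)
instance [StarModule ℂ R] : StarModule ℂ p.Pre := inferInstanceAs (StarModule ℂ R)

/-- The seminorm `p` as a seminorm on `p.Pre`. -/
def preSeminorm : AddGroupSeminorm p.Pre where
  toFun x := p (x : R)
  map_zero' := map_zero p.toSeminorm
  add_le' _ _ := map_add_le_add p.toSeminorm _ _
  neg' _ := map_neg_eq_map p.toSeminorm _

instance : NonUnitalSeminormedRing p.Pre :=
  { (preSeminorm p).toSeminormedAddCommGroup,
    (inferInstance : NonUnitalRing p.Pre) with
    norm_mul_le := fun x y => p.mul_le x y }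

instance : NormedSpace ℂ p.Pre where
  norm_smul_le a x := (map_smul_eq_mul p.toSeminorm a x).le

instance : NormedStarGroup p.Pre where
  norm_star_le x := (p.star_eq x).le

theorem pre_norm_def (x : p.Pre) : ‖x‖ = p x := rfl

/-- The Hausdorff completion of `R` with respect to the `C*`-seminorm `p`, i.e. the completion of
the quotient of `R` by the null space of `p`. -/
def Completion : Type _ := UniformSpace.Completion p.Pre

namespace Completion

open UniformSpace UniformSpace.Completion

instance : NormedAddCommGroup p.Completion :=
  inferInstanceAs (NormedAddCommGroup (UniformSpace.Completion p.Pre))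
instance : NormedSpace ℂ p.Completion :=
  inferInstanceAs (NormedSpace ℂ (UniformSpace.Completion p.Pre))
instance : CompleteSpace p.Completion :=
  inferInstanceAs (CompleteSpace (UniformSpace.Completion p.Pre))

instance : ContinuousConstSMul ℂ p.Completion :=
  inferInstanceAs (ContinuousConstSMul ℂ (UniformSpace.Completion p.Pre))

/-- The canonical map from `R` to its completion. -/
def coe (x : p.Pre) : p.Completion := (x : UniformSpace.Completion p.Pre)

theorem coe_isDenseInducing : IsDenseInducing (coe p) :=
  UniformSpace.Completion.isDenseInducing_coe

theorem coe_continuous : Continuous (coe p) := UniformSpace.Completion.continuous_coe _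

theorem coe_add (x y : p.Pre) : coe p (x + y) = coe p x + coe p y :=
  UniformSpace.Completion.coe_add x y

theorem coe_zero : coe p 0 = 0 := rfl

theorem coe_smul (a : ℂ) (x : p.Pre) : coe p (a • x) = a • coe p x :=
  UniformSpace.Completion.coe_smul a x

theorem norm_coe (x : p.Pre) : ‖coe p x‖ = p x := UniformSpace.Completion.norm_coe x

/-- The multiplication on the completion, extending that of `R` by continuity. -/
instance : Mul p.Completion :=
  ⟨Function.curry <| ((coe_isDenseInducing p).prodMap (coe_isDenseInducing p)).extend
    (coe p ∘ Function.uncurry (· * ·))⟩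

/-- The involution on the completion, extending that of `R` by continuity. -/
instance : Star p.Completion :=
  ⟨(coe_isDenseInducing p).extend (coe p ∘ star)⟩

theorem coe_mul (x y : p.Pre) : coe p (x * y) = coe p x * coe p y :=
  (((coe_isDenseInducing p).prodMap (coe_isDenseInducing p)).extend_eq
    ((coe_continuous p).comp (continuous_mul (M := p.Pre))) (x, y)).symm

theorem coe_star (x : p.Pre) : coe p (star x) = star (coe p x) :=
  ((coe_isDenseInducing p).extend_eq
    ((coe_continuous p).comp (continuous_star (R := p.Pre))) x).symm

instance : ContinuousMul p.Completion where
  continuous_mul := by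
    let c : p.Pre →+ p.Completion :=
      { toFun := coe p, map_zero' := coe_zero p, map_add' := coe_add p }
    let m := (AddMonoidHom.mul : p.Pre →+ p.Pre →+ p.Pre).compr₂ c
    have h : Continuous fun q : p.Pre × p.Pre => m q.1 q.2 :=
      (coe_continuous p).comp continuous_mul
    have di : IsDenseInducing (c : p.Pre → p.Completion) := coe_isDenseInducing p
    exact (di.extend_Z_bilin di h :)

@[elab_as_elim]
theorem induction_on {P : p.Completion → Prop} (x : p.Completion)
    (hc : IsClosed {x | P x}) (h : ∀ a : p.Pre, P (coe p a)) : P x :=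
  UniformSpace.Completion.induction_on x hc h

@[elab_as_elim]
theorem induction_on₂ {P : p.Completion → p.Completion → Prop} (x y : p.Completion)
    (hc : IsClosed {q : p.Completion × p.Completion | P q.1 q.2})
    (h : ∀ a b : p.Pre, P (coe p a) (coe p b)) : P x y :=
  UniformSpace.Completion.induction_on₂ x y hc h

@[elab_as_elim]
theorem induction_on₃ {P : p.Completion → p.Completion → p.Completion → Prop}
    (x y z : p.Completion)
    (hc : IsClosed {q : p.Completion × p.Completion × p.Completion | P q.1 q.2.1 q.2.2})
    (h : ∀ a b c : p.Pre, P (coe p a) (coe p b) (coe p c)) : P x y z :=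
  UniformSpace.Completion.induction_on₃ x y z hc h

instance : ContinuousStar p.Completion where
  continuous_star := by
    have hu : UniformContinuous (coe p ∘ (star : p.Pre → p.Pre)) := by
      have h1 : UniformContinuous (coe p) := UniformSpace.Completion.uniformContinuous_coe _
      have h2 : UniformContinuous (star : p.Pre → p.Pre) :=
        (starNormedAddGroupHom : NormedAddGroupHom p.Pre p.Pre).uniformContinuous
      exact h1.comp h2
    exact (uniformContinuous_uniformly_extend
      (UniformSpace.Completion.isUniformInducing_coe p.Pre)
      (coe_isDenseInducing p).dense hu).continuous

instance : NonUnitalRing p.Completion :=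
  { (inferInstance : AddCommGroup p.Completion), (inferInstance : Mul p.Completion) with
    zero_mul := fun a => by
      refine induction_on p a (isClosed_eq (by fun_prop) continuous_const) fun a => ?_
      rw [← coe_zero, ← coe_mul, zero_mul]
    mul_zero := fun a => by
      refine induction_on p a (isClosed_eq (by fun_prop) continuous_const) fun a => ?_
      rw [← coe_zero, ← coe_mul, mul_zero]
    mul_assoc := fun a b c => by
      refine induction_on₃ p a b c (isClosed_eq (by fun_prop) (by fun_prop)) fun a b c => ?_
      rw [← coe_mul, ← coe_mul, ← coe_mul, ← coe_mul, mul_assoc]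
    left_distrib := fun a b c => by
      refine induction_on₃ p a b c (isClosed_eq (by fun_prop) (by fun_prop)) fun a b c => ?_
      rw [← coe_add, ← coe_mul, ← coe_mul, ← coe_mul, ← coe_add, mul_add]
    right_distrib := fun a b c => by
      refine induction_on₃ p a b c (isClosed_eq (by fun_prop) (by fun_prop)) fun a b c => ?_
      rw [← coe_add, ← coe_mul, ← coe_mul, ← coe_mul, ← coe_add, add_mul] }

instance : NonUnitalNormedRing p.Completion :=
  { (inferInstance : NormedAddCommGroup p.Completion),
    (inferInstance : NonUnitalRing p.Completion) with
    norm_mul_le := fun a b => by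
      refine induction_on₂ p a b (isClosed_le (by fun_prop) (by fun_prop)) fun a b => ?_
      rw [← coe_mul, norm_coe, norm_coe, norm_coe]
      exact p.mul_le a b }

instance : StarRing p.Completion where
  star_involutive := fun a => by
    refine induction_on p a (isClosed_eq (by fun_prop) (by fun_prop)) fun a => ?_
    rw [← coe_star, ← coe_star, star_star]
  star_mul := fun a b => by
    refine induction_on₂ p a b (isClosed_eq (by fun_prop) (by fun_prop)) fun a b => ?_
    rw [← coe_mul, ← coe_star, ← coe_star, ← coe_star, ← coe_mul, star_mul]
  star_add := fun a b => by
    refine induction_on₂ p a b (isClosed_eq (by fun_prop) (by fun_prop)) fun a b => ?_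
    rw [← coe_add, ← coe_star, ← coe_star, ← coe_star, ← coe_add, star_add]

instance : CStarRing p.Completion where
  norm_mul_self_le := fun a => by
    refine induction_on p a (isClosed_le (by fun_prop) (by fun_prop)) fun a => ?_
    rw [← coe_star, ← coe_mul, norm_coe, norm_coe, ← sq]
    exact (p.star_mul_self a).ge

theorem star_smul' [StarModule ℂ R] (c : ℂ) (a : p.Completion) :
    star (c • a) = star c • star a := by
  refine induction_on p a (isClosed_eq (continuous_star.comp (continuous_const_smul c))
    ((continuous_const_smul (star c)).comp continuous_star)) fun a => ?_
  rw [← coe_smul, ← coe_star, ← coe_star, ← coe_smul, star_smul]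

theorem smul_mul_assoc' [IsScalarTower ℂ R R] (c : ℂ) (a b : p.Completion) :
    (c • a) * b = c • (a * b) := by
  refine induction_on₂ p a b (isClosed_eq
    (((continuous_const_smul c).comp continuous_fst).mul continuous_snd)
    ((continuous_const_smul c).comp continuous_mul)) fun a b => ?_
  rw [← coe_smul, ← coe_mul, ← coe_mul, ← coe_smul, smul_mul_assoc]

theorem mul_smul_comm' [SMulCommClass ℂ R R] (c : ℂ) (a b : p.Completion) :
    a * (c • b) = c • (a * b) := by
  refine induction_on₂ p a b (isClosed_eq
    (continuous_fst.mul ((continuous_const_smul c).comp continuous_snd))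
    ((continuous_const_smul c).comp continuous_mul)) fun a b => ?_
  rw [← coe_smul, ← coe_mul, ← coe_mul, ← coe_smul, mul_smul_comm]

instance [StarModule ℂ R] : StarModule ℂ p.Completion := ⟨star_smul' p⟩

instance [IsScalarTower ℂ R R] : IsScalarTower ℂ p.Completion p.Completion :=
  ⟨smul_mul_assoc' p⟩

instance [SMulCommClass ℂ R R] : SMulCommClass ℂ p.Completion p.Completion :=
  ⟨fun c a b => (mul_smul_comm' p c a b).symm⟩

instance [StarModule ℂ R] [IsScalarTower ℂ R R] [SMulCommClass ℂ R R] :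
    NonUnitalCStarAlgebra p.Completion where

/-- The canonical `*`-homomorphism from `R` to its completion. -/
def of : R →⋆ₙₐ[ℂ] p.Completion where
  toFun x := coe p x
  map_smul' a x := coe_smul p a x
  map_zero' := coe_zero p
  map_add' := coe_add p
  map_mul' := coe_mul p
  map_star' := coe_star p

theorem norm_of (x : R) : ‖of p x‖ = p x := norm_coe p x

end Completion

end CStarSeminorm

/-- A `C*`-seminorm on a `C*`-algebra is dominated by the norm. -/
theorem CStarSeminorm.le_norm {A : Type*} [NonUnitalCStarAlgebra A] (p : CStarSeminorm A) (a : A) :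
    p a ≤ ‖a‖ := by
  rw [← CStarSeminorm.Completion.norm_of]
  exact NonUnitalStarAlgHom.norm_apply_le _ a

variable (R) in
/-- The `*`-algebra `R` has an enveloping `C*`-algebra: the supremum of all `C*`-seminorms is
finite at every element. -/
class HasEnvelopingCStarAlgebra : Prop where
  bddAbove : ∀ x : R, BddAbove (Set.range fun p : CStarSeminorm R => p x)

instance : Nonempty (CStarSeminorm R) :=
  ⟨{ (0 : Seminorm ℂ R) with
      star_mul_self' := fun x => by
        change (0 : Seminorm ℂ R) _ = (0 : Seminorm ℂ R) _ ^ 2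
        simp
      mul_le' := fun x y => by
        change (0 : Seminorm ℂ R) _ ≤ (0 : Seminorm ℂ R) _ * (0 : Seminorm ℂ R) _
        simp }⟩

variable (R) in
/-- The universal `C*`-seminorm `‖x‖ = sup {p x | p a C*-seminorm on R}`. -/
def universalCStarSeminorm [h : HasEnvelopingCStarAlgebra R] : CStarSeminorm R where
  toFun x := ⨆ p : CStarSeminorm R, p x
  map_zero' := by simp
  add_le' x y := ciSup_le fun p => (map_add_le_add p.toSeminorm x y).trans
    (add_le_add (le_ciSup (h.bddAbove x) p) (le_ciSup (h.bddAbove y) p))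
  neg' x := by simp
  smul' a x := by
    simp only [map_smul_eq_mul]
    rw [Real.mul_iSup_of_nonneg (norm_nonneg a)]
  star_mul_self' x := by
    simp only [CStarSeminorm.star_mul_self]
    apply le_antisymm
    · exact ciSup_le fun p => pow_le_pow_left₀ (p.nonneg x) (le_ciSup (h.bddAbove x) p) 2
    · have h0 : 0 ≤ ⨆ p : CStarSeminorm R, p x ^ 2 := Real.iSup_nonneg fun p => sq_nonneg _
      have hb : BddAbove (Set.range fun p : CStarSeminorm R => p x ^ 2) := by
        simpa only [CStarSeminorm.star_mul_self] using h.bddAbove (star x * x)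
      rw [← Real.le_sqrt (Real.iSup_nonneg fun p => p.nonneg x) h0]
      exact ciSup_le fun p => Real.le_sqrt_of_sq_le (le_ciSup hb p)
  mul_le' x y := ciSup_le fun p => (p.mul_le x y).trans
    (mul_le_mul (le_ciSup (h.bddAbove x) p) (le_ciSup (h.bddAbove y) p) (p.nonneg y)
      (Real.iSup_nonneg fun p => p.nonneg x))

variable (R) in
/-- The enveloping `C*`-algebra of a `*`-algebra: the Hausdorff completion with respect to the
universal `C*`-seminorm. -/
abbrev EnvelopingCStarAlgebra [HasEnvelopingCStarAlgebra R] : Type _ :=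
  (universalCStarSeminorm R).Completion

/-- The canonical `*`-homomorphism from a `*`-algebra to its enveloping `C*`-algebra. -/
def toEnveloping [HasEnvelopingCStarAlgebra R] : R →⋆ₙₐ[ℂ] EnvelopingCStarAlgebra R :=
  CStarSeminorm.Completion.of (universalCStarSeminorm R)

end Enveloping

/-! ### The full group C*-algebra of a discrete group -/

section GroupAlgebra

variable (K : Type*) [Group K]

/-- The involution of the group algebra `ℂ[K]`: `f* (s) = conj (f (s⁻¹))`. -/
instance : Star (MonoidAlgebra ℂ K) :=
  ⟨fun f => f.coeff.sum fun s a => MonoidAlgebra.single s⁻¹ (star a)⟩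

variable {K}

theorem groupAlgebra_star_single (s : K) (a : ℂ) :
    star (MonoidAlgebra.single s a) = MonoidAlgebra.single s⁻¹ (star a) := by
  change (MonoidAlgebra.single s a).coeff.sum _ = _
  rw [MonoidAlgebra.coeff_single, Finsupp.sum_single_index]
  simp

theorem groupAlgebra_star_add (f g : MonoidAlgebra ℂ K) : star (f + g) = star f + star g := by
  change (f + g).coeff.sum _ = f.coeff.sum _ + g.coeff.sum _
  rw [MonoidAlgebra.coeff_add, Finsupp.sum_add_index'] <;> simp [MonoidAlgebra.single_add]

theorem groupAlgebra_star_zero : star (0 : MonoidAlgebra ℂ K) = 0 := by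
  change (0 : MonoidAlgebra ℂ K).coeff.sum _ = _
  simp

instance : StarRing (MonoidAlgebra ℂ K) where
  star_involutive f := by
    induction f using MonoidAlgebra.induction_linear with
    | zero => simp [groupAlgebra_star_zero]
    | add f g hf hg => rw [groupAlgebra_star_add, groupAlgebra_star_add, hf, hg]
    | single s a => simp [groupAlgebra_star_single]
  star_mul f g := by
    induction f using MonoidAlgebra.induction_linear with
    | zero => simp [groupAlgebra_star_zero]
    | add f₁ f₂ h₁ h₂ =>
      rw [groupAlgebra_star_add, add_mul, groupAlgebra_star_add, h₁, h₂, mul_add]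
    | single s a =>
      induction g using MonoidAlgebra.induction_linear with
      | zero => simp [groupAlgebra_star_zero]
      | add g₁ g₂ h₁ h₂ =>
        rw [groupAlgebra_star_add, mul_add, groupAlgebra_star_add, h₁, h₂, add_mul]
      | single t b =>
        simp [groupAlgebra_star_single, MonoidAlgebra.single_mul_single, mul_comm]
  star_add := groupAlgebra_star_add

instance : StarModule ℂ (MonoidAlgebra ℂ K) where
  star_smul c f := by
    induction f using MonoidAlgebra.induction_linear with
    | zero => simp
    | add f g hf hg => rw [smul_add, star_add, hf, hg, star_add, smul_add]
    | single s a => simp [groupAlgebra_star_single, MonoidAlgebra.smul_single]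

theorem groupAlgebra_seminorm_single_le (p : CStarSeminorm (MonoidAlgebra ℂ K)) (s : K) (a : ℂ) :
    p (MonoidAlgebra.single s a) ≤ ‖a‖ := by
  have h1 : p (1 : MonoidAlgebra ℂ K) ≤ 1 := by
    have h := p.star_mul_self (1 : MonoidAlgebra ℂ K)
    rw [star_one, one_mul, sq] at h
    by_contra hc
    push Not at hc
    nlinarith
  have h2 : p (MonoidAlgebra.single s (1 : ℂ)) ≤ 1 := by
    have h := p.star_mul_self (MonoidAlgebra.single s (1 : ℂ))
    rw [groupAlgebra_star_single, MonoidAlgebra.single_mul_single, inv_mul_cancel, star_one,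
      one_mul, ← MonoidAlgebra.one_def] at h
    nlinarith [p.nonneg (MonoidAlgebra.single s (1 : ℂ))]
  have h3 : MonoidAlgebra.single s a = a • MonoidAlgebra.single s (1 : ℂ) := by
    rw [MonoidAlgebra.smul_single, smul_eq_mul, mul_one]
  rw [h3, map_smul_eq_mul p.toSeminorm]
  exact mul_le_of_le_one_right (norm_nonneg a) h2

instance : HasEnvelopingCStarAlgebra (MonoidAlgebra ℂ K) where
  bddAbove f := by
    induction f using MonoidAlgebra.induction_linear with
    | zero => exact ⟨0, by rintro _ ⟨p, rfl⟩; exact (map_zero p.toSeminorm).le⟩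
    | add f g hf hg =>
      obtain ⟨M, hM⟩ := hf
      obtain ⟨N, hN⟩ := hg
      refine ⟨M + N, ?_⟩
      rintro _ ⟨p, rfl⟩
      exact (map_add_le_add p.toSeminorm f g).trans (add_le_add (hM ⟨p, rfl⟩) (hN ⟨p, rfl⟩))
    | single s a => exact ⟨‖a‖, by rintro _ ⟨p, rfl⟩; exact groupAlgebra_seminorm_single_le p s a⟩

variable (K) in
/-- The full group `C*`-algebra `C*(K)` of the discrete group `K`. -/
abbrev GroupCStarAlgebra : Type _ := EnvelopingCStarAlgebra (MonoidAlgebra ℂ K)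

end GroupAlgebra

/-! ### The full crossed product by a discrete group -/

section CrossedProduct

variable {A : Type*} [NonUnitalCStarAlgebra A] {G : Type*} [Group G] (α : G →* (A ≃⋆ₐ[ℂ] A))

/-- The `*`-algebra `C_c(G, A)` of finitely supported functions `G → A`, with the convolution
product and involution twisted by the action `α`. -/
def ConvolutionAlgebra (_ : G →* (A ≃⋆ₐ[ℂ] A)) : Type _ := G →₀ A

namespace ConvolutionAlgebra

instance : AddCommGroup (ConvolutionAlgebra α) := inferInstanceAs (AddCommGroup (G →₀ A))
instance : Module ℂ (ConvolutionAlgebra α) := inferInstanceAs (Module ℂ (G →₀ A))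

/-- The coefficients of an element of `C_c(G, A)`. -/
def coeff (f : ConvolutionAlgebra α) : G →₀ A := f

/-- The element `a ⊗ δ_s`: the function with value `a` at `s` and `0` elsewhere. -/
def single (s : G) (a : A) : ConvolutionAlgebra α := (Finsupp.single s a : G →₀ A)

/-- The product `(f * g) (s) = ∑ t, f t * α t (g (t⁻¹ * s))`; in other words, the bilinear
extension of `(a ⊗ δ_s) * (b ⊗ δ_t) = a * α s b ⊗ δ_{s t}`. -/
instance : Mul (ConvolutionAlgebra α) :=
  ⟨fun f g => (coeff α f).sum fun s a => (coeff α g).sum fun t b => single α (s * t) (a * α s b)⟩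

/-- The involution `f* (s) = α s (star (f s⁻¹))`; in other words, the conjugate linear extension
of `(a ⊗ δ_s)* = α s⁻¹ (star a) ⊗ δ_{s⁻¹}`. -/
instance : Star (ConvolutionAlgebra α) :=
  ⟨fun f => (coeff α f).sum fun s a => single α s⁻¹ (α s⁻¹ (star a))⟩

theorem coeff_single (s : G) (a : A) : coeff α (single α s a) = Finsupp.single s a := rfl
theorem coeff_add (f g : ConvolutionAlgebra α) : coeff α (f + g) = coeff α f + coeff α g := rfl
theorem coeff_zero : coeff α 0 = 0 := rfl
theorem single_zero (s : G) : single α s 0 = 0 := Finsupp.single_zero s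
theorem single_add (s : G) (a b : A) : single α s (a + b) = single α s a + single α s b :=
  Finsupp.single_add s a b
theorem smul_single (c : ℂ) (s : G) (a : A) : c • single α s a = single α s (c • a) :=
  Finsupp.smul_single c s a

theorem induction_linear {P : ConvolutionAlgebra α → Prop} (f : ConvolutionAlgebra α)
    (zero : P 0) (add : ∀ f g, P f → P g → P (f + g)) (single : ∀ s a, P (single α s a)) : P f :=
  Finsupp.induction_linear (f : G →₀ A) zero add single

theorem mul_def (f g : ConvolutionAlgebra α) : f * g =
    (coeff α f).sum fun s a => (coeff α g).sum fun t b => single α (s * t) (a * α s b) := rfl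

theorem star_def (f : ConvolutionAlgebra α) :
    star f = (coeff α f).sum fun s a => single α s⁻¹ (α s⁻¹ (star a)) := rfl

theorem single_mul_single (s t : G) (a b : A) :
    single α s a * single α t b = single α (s * t) (a * α s b) := by
  rw [mul_def, coeff_single, coeff_single, Finsupp.sum_single_index, Finsupp.sum_single_index]
  · simp [single_zero]
  · simp [single_zero]

theorem star_single (s : G) (a : A) : star (single α s a) = single α s⁻¹ (α s⁻¹ (star a)) := by
  rw [star_def, coeff_single, Finsupp.sum_single_index]
  simp [single_zero]

theorem zero_mul' (f : ConvolutionAlgebra α) : 0 * f = 0 := by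
  rw [mul_def, coeff_zero, Finsupp.sum_zero_index]

theorem mul_zero' (f : ConvolutionAlgebra α) : f * 0 = 0 := by
  rw [mul_def, coeff_zero]
  simp

theorem add_mul' (f g h : ConvolutionAlgebra α) : (f + g) * h = f * h + g * h := by
  rw [mul_def, coeff_add, Finsupp.sum_add_index']
  · rfl
  · simp [single_zero]
  · intro s a b
    simp [add_mul, single_add, Finsupp.sum_add]

theorem mul_add' (f g h : ConvolutionAlgebra α) : f * (g + h) = f * g + f * h := by
  rw [mul_def, mul_def, mul_def, ← Finsupp.sum_add]
  refine Finsupp.sum_congr fun s _ => ?_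
  rw [coeff_add, Finsupp.sum_add_index']
  · simp [single_zero]
  · intro t a b
    simp [mul_add, single_add]

theorem star_add' (f g : ConvolutionAlgebra α) : star (f + g) = star f + star g := by
  rw [star_def, coeff_add, Finsupp.sum_add_index']
  · rfl
  · simp [single_zero]
  · intro s a b
    simp [single_add]

theorem star_zero' : star (0 : ConvolutionAlgebra α) = 0 := by
  rw [star_def, coeff_zero, Finsupp.sum_zero_index]

instance : NonUnitalRing (ConvolutionAlgebra α) :=
  { (inferInstance : AddCommGroup (ConvolutionAlgebra α)),
    (inferInstance : Mul (ConvolutionAlgebra α)) with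
    zero_mul := zero_mul' α
    mul_zero := mul_zero' α
    left_distrib := mul_add' α
    right_distrib := add_mul' α
    mul_assoc := fun f g h => by
      induction f using induction_linear α with
      | zero => simp only [zero_mul']
      | add f₁ f₂ h₁ h₂ => simp only [add_mul', h₁, h₂]
      | single s a =>
        induction g using induction_linear α with
        | zero => simp only [zero_mul', mul_zero']
        | add f₁ f₂ h₁ h₂ => simp only [add_mul', mul_add', h₁, h₂]
        | single t b =>
          induction h using induction_linear α with
          | zero => simp only [mul_zero']
          | add f₁ f₂ h₁ h₂ => simp only [mul_add', h₁, h₂]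
          | single r c => simp [single_mul_single, mul_assoc] }

instance : StarRing (ConvolutionAlgebra α) where
  star_involutive f := by
    induction f using induction_linear α with
    | zero => simp only [star_zero']
    | add f g hf hg => simp only [star_add', hf, hg]
    | single s a =>
      rw [star_single, star_single, map_star, map_star, map_star, star_star,
        ← StarAlgEquiv.mul_apply, ← map_mul]
      simp
  star_mul f g := by
    induction f using induction_linear α with
    | zero => simp only [star_zero', zero_mul', mul_zero']
    | add f₁ f₂ h₁ h₂ => simp only [star_add', add_mul', mul_add', h₁, h₂]
    | single s a =>
      induction g using induction_linear α with
      | zero => simp only [star_zero', zero_mul', mul_zero']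
      | add f₁ f₂ h₁ h₂ => simp only [star_add', add_mul', mul_add', h₁, h₂]
      | single t b =>
        simp only [single_mul_single, star_single, star_mul, map_mul, mul_inv_rev, map_star,
          StarAlgEquiv.mul_apply]
        rw [← StarAlgEquiv.mul_apply (α s⁻¹) (α s), ← map_mul]
        simp
  star_add := star_add' α

instance : IsScalarTower ℂ (ConvolutionAlgebra α) (ConvolutionAlgebra α) where
  smul_assoc c f g := by
    simp only [smul_eq_mul]
    induction f using induction_linear α with
    | zero => simp
    | add f₁ f₂ h₁ h₂ => simp only [smul_add, add_mul, h₁, h₂]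
    | single s a =>
      induction g using induction_linear α with
      | zero => simp
      | add f₁ f₂ h₁ h₂ => simp only [smul_add, mul_add, h₁, h₂]
      | single t b => simp only [smul_single, single_mul_single, smul_mul_assoc]

instance : SMulCommClass ℂ (ConvolutionAlgebra α) (ConvolutionAlgebra α) where
  smul_comm c f g := by
    simp only [smul_eq_mul]
    induction f using induction_linear α with
    | zero => simp
    | add f₁ f₂ h₁ h₂ => simp only [smul_add, add_mul, h₁, h₂]
    | single s a =>
      induction g using induction_linear α with
      | zero => simp
      | add f₁ f₂ h₁ h₂ => simp only [smul_add, mul_add, h₁, h₂]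
      | single t b => simp only [smul_single, single_mul_single, map_smul, mul_smul_comm]

instance : StarModule ℂ (ConvolutionAlgebra α) where
  star_smul c f := by
    induction f using induction_linear α with
    | zero => simp
    | add f₁ f₂ h₁ h₂ => simp only [smul_add, star_add, h₁, h₂]
    | single s a => simp only [smul_single, star_single, star_smul, map_smul]

/-- The restriction of a `C*`-seminorm on `C_c(G, A)` to the copy `a ↦ a ⊗ δ_1` of `A`. -/
def restrictSeminorm (p : CStarSeminorm (ConvolutionAlgebra α)) : CStarSeminorm A where
  toFun a := p (single α 1 a)
  map_zero' := by rw [single_zero]; exact map_zero p.toSeminorm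
  add_le' a b := by rw [single_add]; exact map_add_le_add p.toSeminorm _ _
  neg' a := by
    have h : single α 1 (-a) = - single α 1 a := Finsupp.single_neg (1 : G) a
    rw [h]; exact map_neg_eq_map p.toSeminorm _
  smul' c a := by rw [← smul_single]; exact map_smul_eq_mul p.toSeminorm _ _
  star_mul_self' a := by
    have h : single α 1 (star a * a) = star (single α 1 a) * single α 1 a := by
      rw [star_single, single_mul_single]; simp
    rw [h]; exact p.star_mul_self _
  mul_le' a b := by
    have h : single α 1 (a * b) = single α 1 a * single α 1 b := by
      rw [single_mul_single]; simp
    rw [h]; exact p.mul_le _ _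

theorem seminorm_single_le (p : CStarSeminorm (ConvolutionAlgebra α)) (s : G) (a : A) :
    p (single α s a) ≤ ‖a‖ := by
  have h1 : p (single α s a) ^ 2 ≤ ‖a‖ ^ 2 := by
    rw [← p.star_mul_self, star_single, single_mul_single, ← map_mul, inv_mul_cancel]
    refine ((restrictSeminorm α p).le_norm _).trans ?_
    refine (NonUnitalStarAlgHom.norm_apply_le (α s⁻¹) _).trans ?_
    rw [CStarRing.norm_star_mul_self, sq]
  exact le_of_sq_le_sq h1 (norm_nonneg a)

instance : HasEnvelopingCStarAlgebra (ConvolutionAlgebra α) where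
  bddAbove f := by
    induction f using induction_linear α with
    | zero => exact ⟨0, by rintro _ ⟨p, rfl⟩; exact (map_zero p.toSeminorm).le⟩
    | add f g hf hg =>
      obtain ⟨M, hM⟩ := hf
      obtain ⟨N, hN⟩ := hg
      refine ⟨M + N, ?_⟩
      rintro _ ⟨p, rfl⟩
      exact (map_add_le_add p.toSeminorm f g).trans (add_le_add (hM ⟨p, rfl⟩) (hN ⟨p, rfl⟩))
    | single s a => exact ⟨‖a‖, by rintro _ ⟨p, rfl⟩; exact seminorm_single_le α p s a⟩

end ConvolutionAlgebra

/-- The full crossed product `A ⋊_α G` of a `C*`-algebra by an action of a discrete group: the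
enveloping `C*`-algebra of `C_c(G, A)`. -/
abbrev CrossedProduct : Type _ := EnvelopingCStarAlgebra (ConvolutionAlgebra α)

end CrossedProduct

/-! ### Imprimitivity bimodules and Morita equivalence -/

section Morita

attribute [local instance] CStarAlgebra.spectralOrder

/-- `IsCompleteForInner ip` says that `E` is complete for the norm `‖x‖ = ‖ip x x‖ ^ (1/2)`
induced by the inner product `ip`. -/
def IsCompleteForInner {A E : Type*} [Norm A] [AddCommGroup E] (ip : E → E → A) : Prop :=
  ∀ x : ℕ → E,
    (∀ ε > 0, ∃ N, ∀ m ≥ N, ∀ n ≥ N, √‖ip (x m - x n) (x m - x n)‖ < ε) →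
    ∃ y : E, ∀ ε > 0, ∃ N, ∀ n ≥ N, √‖ip (x n - y) (x n - y)‖ < ε

/-- The maps `la : A × E → E` and `ra : E × B → E` are a left action of the algebra `A` and a
right action of the algebra `B` on the complex vector space `E`, and the two actions commute. -/
structure IsBimodule {A B E : Type*} [NonUnitalRing A] [Module ℂ A] [NonUnitalRing B] [Module ℂ B]
    [AddCommGroup E] [Module ℂ E] (la : A → E → E) (ra : E → B → E) : Prop where
  left_add : ∀ a x y, la a (x + y) = la a x + la a y
  add_left : ∀ a b x, la (a + b) x = la a x + la b x
  left_smul : ∀ (c : ℂ) a x, la a (c • x) = c • la a x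
  smul_left : ∀ (c : ℂ) a x, la (c • a) x = c • la a x
  mul_left : ∀ a b x, la (a * b) x = la a (la b x)
  add_right : ∀ x y b, ra (x + y) b = ra x b + ra y b
  right_add : ∀ x b b', ra x (b + b') = ra x b + ra x b'
  smul_right : ∀ (c : ℂ) x b, ra (c • x) b = c • ra x b
  right_smul : ∀ (c : ℂ) x b, ra x (c • b) = c • ra x b
  right_mul : ∀ x b b', ra x (b * b') = ra (ra x b) b'
  left_right : ∀ a x b, ra (la a x) b = la a (ra x b)

/-- `E`, with left action `la`, right action `ra`, `A`-valued inner product `ipA` and `B`-valued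
inner product `ipB`, is an `A`-`B` imprimitivity bimodule. -/
structure IsImprimitivityBimodule {A B E : Type*} [NonUnitalCStarAlgebra A]
    [NonUnitalCStarAlgebra B] [AddCommGroup E] [Module ℂ E]
    (la : A → E → E) (ra : E → B → E) (ipA : E → E → A) (ipB : E → E → B) : Prop
    extends IsBimodule la ra where
  ipA_add_left : ∀ x y z, ipA (x + y) z = ipA x z + ipA y z
  ipA_smul_left : ∀ (c : ℂ) x y, ipA (c • x) y = c • ipA x y
  ipA_left : ∀ a x y, ipA (la a x) y = a * ipA x y
  ipA_star : ∀ x y, star (ipA x y) = ipA y x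
  ipA_nonneg : ∀ x, 0 ≤ ipA x x
  ipA_definite : ∀ x, ipA x x = 0 → x = 0
  ipB_add_right : ∀ x y z, ipB x (y + z) = ipB x y + ipB x z
  ipB_smul_right : ∀ (c : ℂ) x y, ipB x (c • y) = c • ipB x y
  ipB_right : ∀ x y b, ipB x (ra y b) = ipB x y * b
  ipB_star : ∀ x y, star (ipB x y) = ipB y x
  ipB_nonneg : ∀ x, 0 ≤ ipB x x
  ipB_definite : ∀ x, ipB x x = 0 → x = 0
  ipB_left : ∀ a x y, ipB (la a x) y = ipB x (la (star a) y)
  ipA_right : ∀ b x y, ipA (ra x b) y = ipA x (ra y (star b))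
  left_ipA : ∀ x y z, la (ipA x y) z = ra x (ipB y z)
  dense_ipA : Dense (Submodule.span ℂ (Set.range fun q : E × E => ipA q.1 q.2) : Set A)
  dense_ipB : Dense (Submodule.span ℂ (Set.range fun q : E × E => ipB q.1 q.2) : Set B)
  complete_ipA : IsCompleteForInner ipA
  complete_ipB : IsCompleteForInner ipB

/-- The `C*`-algebras `A` and `B` are (strongly) Morita equivalent: there is an `A`-`B`
imprimitivity bimodule. -/
def MoritaEquivalent (A B : Type u) [NonUnitalCStarAlgebra A] [NonUnitalCStarAlgebra B] : Prop :=
  ∃ (E : Type u) (_ : AddCommGroup E) (_ : Module ℂ E)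
    (la : A → E → E) (ra : E → B → E) (ipA : E → E → A) (ipB : E → E → B),
    IsImprimitivityBimodule la ra ipA ipB

/-- Let `ιA : A₀ → A` and `ιB : B₀ → B` be embeddings of `*`-algebras onto dense `*`-subalgebras
of `C*`-algebras. Then `E₀`, with left action `la`, right action `ra`, `A₀`-valued form `ipA` and
`B₀`-valued form `ipB`, is a pre `A₀`-`B₀` imprimitivity bimodule. Norms and the order on `A₀` and
`B₀` are those of `A` and `B`. -/
structure IsPreImprimitivityBimodule {A B A₀ B₀ E₀ : Type*}
    [NonUnitalCStarAlgebra A] [NonUnitalCStarAlgebra B]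
    [NonUnitalRing A₀] [StarRing A₀] [Module ℂ A₀] [NonUnitalRing B₀] [StarRing B₀] [Module ℂ B₀]
    [AddCommGroup E₀] [Module ℂ E₀] (ιA : A₀ →⋆ₙₐ[ℂ] A) (ιB : B₀ →⋆ₙₐ[ℂ] B)
    (la : A₀ → E₀ → E₀) (ra : E₀ → B₀ → E₀) (ipA : E₀ → E₀ → A₀) (ipB : E₀ → E₀ → B₀) : Prop
    extends IsBimodule la ra where
  injective_ιA : Function.Injective ιA
  injective_ιB : Function.Injective ιB
  denseRange_ιA : DenseRange ιA
  denseRange_ιB : DenseRange ιB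
  ipA_add_left : ∀ x y z, ipA (x + y) z = ipA x z + ipA y z
  ipA_smul_left : ∀ (c : ℂ) x y, ipA (c • x) y = c • ipA x y
  ipA_left : ∀ a x y, ipA (la a x) y = a * ipA x y
  ipA_star : ∀ x y, star (ipA x y) = ipA y x
  ipA_nonneg : ∀ x, 0 ≤ ιA (ipA x x)
  ipB_add_right : ∀ x y z, ipB x (y + z) = ipB x y + ipB x z
  ipB_smul_right : ∀ (c : ℂ) x y, ipB x (c • y) = c • ipB x y
  ipB_right : ∀ x y b, ipB x (ra y b) = ipB x y * b
  ipB_star : ∀ x y, star (ipB x y) = ipB y x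
  ipB_nonneg : ∀ x, 0 ≤ ιB (ipB x x)
  ipB_left : ∀ a x y, ipB (la a x) y = ipB x (la (star a) y)
  ipA_right : ∀ b x y, ipA (ra x b) y = ipA x (ra y (star b))
  left_ipA : ∀ x y z, la (ipA x y) z = ra x (ipB y z)
  ipB_bounded : ∀ a x, ιB (ipB (la a x) (la a x)) ≤ ((‖ιA a‖ ^ 2 : ℝ) : ℂ) • ιB (ipB x x)
  ipA_bounded : ∀ b x, ιA (ipA (ra x b) (ra x b)) ≤ ((‖ιB b‖ ^ 2 : ℝ) : ℂ) • ιA (ipA x x)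
  dense_ipA : Dense (ιA '' (Submodule.span ℂ (Set.range fun q : E₀ × E₀ => ipA q.1 q.2) : Set A₀))
  dense_ipB : Dense (ιB '' (Submodule.span ℂ (Set.range fun q : E₀ × E₀ => ipB q.1 q.2) : Set B₀))

/-- The linear map `j : E₀ → E` exhibits the bimodule `E` over `A`, `B` as the (Hausdorff)
completion of the bimodule `E₀` over `A₀`, `B₀`: it intertwines the actions, preserves the inner
products, and has dense range for the norm of `E`. -/
structure IsBimoduleCompletion {A B A₀ B₀ E₀ E : Type*}
    [NonUnitalCStarAlgebra A] [NonUnitalCStarAlgebra B]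
    [NonUnitalRing A₀] [StarRing A₀] [Module ℂ A₀] [NonUnitalRing B₀] [StarRing B₀] [Module ℂ B₀]
    [AddCommGroup E₀] [Module ℂ E₀] [AddCommGroup E] [Module ℂ E]
    (ιA : A₀ →⋆ₙₐ[ℂ] A) (ιB : B₀ →⋆ₙₐ[ℂ] B)
    (la₀ : A₀ → E₀ → E₀) (ra₀ : E₀ → B₀ → E₀) (ipA₀ : E₀ → E₀ → A₀) (ipB₀ : E₀ → E₀ → B₀)
    (la : A → E → E) (ra : E → B → E) (ipA : E → E → A) (ipB : E → E → B)
    (j : E₀ →ₗ[ℂ] E) : Prop where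
  map_left : ∀ a x, j (la₀ a x) = la (ιA a) (j x)
  map_right : ∀ x b, j (ra₀ x b) = ra (j x) (ιB b)
  map_ipA : ∀ x y, ipA (j x) (j y) = ιA (ipA₀ x y)
  map_ipB : ∀ x y, ipB (j x) (j y) = ιB (ipB₀ x y)
  dense_ipA : ∀ z : E, ∀ ε > 0, ∃ x : E₀, √‖ipA (z - j x) (z - j x)‖ < ε
  dense_ipB : ∀ z : E, ∀ ε > 0, ∃ x : E₀, √‖ipB (z - j x) (z - j x)‖ < ε

end Morita

/-! ### The bimodule `C_c(G)` -/

section Translation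

variable (G : Type*) [Group G] (X : Type*) [TopologicalSpace X] [MulAction G X]
  [ContinuousConstSMul G X]

/-- The action of `G` on `C₀(X)` by translations, `(α s f) (x) = f (s⁻¹ • x)`. -/
def translationAction : G →* (C₀(X, ℂ) ≃⋆ₐ[ℂ] C₀(X, ℂ)) where
  toFun s :=
    { toFun := fun f => f.comp (Homeomorph.smul s⁻¹ : X ≃ₜ X).toCocompactMap
      invFun := fun f => f.comp (Homeomorph.smul s : X ≃ₜ X).toCocompactMap
      left_inv := fun f => by ext x; simp
      right_inv := fun f => by ext x; simp
      map_mul' := fun f g => rfl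
      map_add' := fun f g => rfl
      map_star' := fun f => rfl
      map_smul' := fun c f => rfl }
  map_one' := by ext f x; simp
  map_mul' s t := by
    ext f x
    change f ((s * t)⁻¹ • x) = f (t⁻¹ • s⁻¹ • x)
    rw [mul_inv_rev, mul_smul]

end Translation

section Bimodule

/-- The characteristic function of the point `x` of a discrete space, as an element of `C₀`. -/
def pointIndicator {X : Type*} [TopologicalSpace X] [DiscreteTopology X] (x : X) : C₀(X, ℂ) where
  toFun := Set.indicator {x} 1
  continuous_toFun := continuous_of_discreteTopology
  zero_at_infty' := by
    refine tendsto_const_nhds.congr' ?_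
    have h : ({x} : Set X)ᶜ ∈ Filter.cocompact X := isCompact_singleton.compl_mem_cocompact
    filter_upwards [h] with y hy
    exact (Set.indicator_of_notMem hy _).symm

variable {G : Type u} [Group G] [TopologicalSpace G] [DiscreteTopology G] (H : Subgroup G)

instance : DiscreteTopology (G ⧸ H) := QuotientGroup.discreteTopology (isOpen_discrete _)

/-- The `*`-algebra `C_c(G, C₀(G/H))`, for the action of `G` on `C₀(G/H)` by left translation. -/
abbrev CosetConvolutionAlgebra : Type u := ConvolutionAlgebra (translationAction G (G ⧸ H))

/-- The crossed product `C₀(G/H) ⋊ G`. -/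
abbrev CosetCrossedProduct : Type u := CrossedProduct (translationAction G (G ⧸ H))

/-- The element `e_{rH} ⊗ δ_s` of `C_c(G, C₀(G/H))`. -/
def cosetUnit (r s : G) : CosetConvolutionAlgebra H :=
  ConvolutionAlgebra.single (translationAction G (G ⧸ H)) s (pointIndicator (r : G ⧸ H))

theorem translationAction_pointIndicator (s r : G) :
    translationAction G (G ⧸ H) s (pointIndicator (r : G ⧸ H)) =
      pointIndicator ((s * r : G) : G ⧸ H) := by
  ext x
  change Set.indicator {(r : G ⧸ H)} (1 : G ⧸ H → ℂ) (s⁻¹ • x) =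
    Set.indicator {((s * r : G) : G ⧸ H)} (1 : G ⧸ H → ℂ) x
  have h : s⁻¹ • x = (r : G ⧸ H) ↔ x = ((s * r : G) : G ⧸ H) := by
    rw [inv_smul_eq_iff]; rfl
  by_cases hx : x = ((s * r : G) : G ⧸ H)
  · simp [hx]
  · have := mt h.1 hx
    simp [hx, this]

theorem pointIndicator_mul {X : Type*} [TopologicalSpace X] [DiscreteTopology X] (x y : X) :
    pointIndicator x * pointIndicator y = pointIndicator x ∨
      pointIndicator x * pointIndicator y = 0 := by
  by_cases h : x = y
  · left
    subst h
    ext z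
    change Set.indicator {x} (1 : X → ℂ) z * Set.indicator {x} (1 : X → ℂ) z = Set.indicator {x} 1 z
    by_cases hz : z = x <;> simp [hz]
  · right
    ext z
    change Set.indicator {x} (1 : X → ℂ) z * Set.indicator {y} (1 : X → ℂ) z = 0
    by_cases hz : z = x
    · subst hz; simp [h]
    · simp [hz]

theorem star_pointIndicator {X : Type*} [TopologicalSpace X] [DiscreteTopology X] (x : X) :
    star (pointIndicator x) = pointIndicator x := by
  ext z
  change star (Set.indicator {x} (1 : X → ℂ) z) = Set.indicator {x} 1 z
  by_cases hz : z = x <;> simp [hz]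

theorem cosetUnit_mul_mem (r s r' s' : G) : cosetUnit H r s * cosetUnit H r' s' ∈
    Submodule.span ℂ (Set.range fun q : G × G => cosetUnit H q.1 q.2) := by
  rw [cosetUnit, cosetUnit, ConvolutionAlgebra.single_mul_single,
    translationAction_pointIndicator]
  rcases pointIndicator_mul (r : G ⧸ H) ((s * r' : G) : G ⧸ H) with h | h
  · rw [h]; exact Submodule.subset_span ⟨(r, s * s'), rfl⟩
  · rw [h, ConvolutionAlgebra.single_zero]; exact Submodule.zero_mem _

theorem star_cosetUnit (r s : G) : star (cosetUnit H r s) = cosetUnit H (s⁻¹ * r) s⁻¹ := by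
  rw [cosetUnit, ConvolutionAlgebra.star_single, star_pointIndicator,
    translationAction_pointIndicator, cosetUnit]

/-- The `*`-algebra `A₀`, the linear span of the elements `e_{rH} ⊗ δ_s` for `r, s ∈ G`. -/
def cosetSpan : NonUnitalStarSubalgebra ℂ (CosetConvolutionAlgebra H) where
  toNonUnitalSubalgebra :=
    { Submodule.span ℂ (Set.range fun q : G × G => cosetUnit H q.1 q.2) with
      mul_mem' := by
        intro f g hf hg
        change f ∈ Submodule.span ℂ (Set.range fun q : G × G => cosetUnit H q.1 q.2) at hf
        change g ∈ Submodule.span ℂ (Set.range fun q : G × G => cosetUnit H q.1 q.2) at hg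
        change f * g ∈ Submodule.span ℂ (Set.range fun q : G × G => cosetUnit H q.1 q.2)
        induction hf, hg using Submodule.span_induction₂ with
        | mem_mem x y hx hy =>
          obtain ⟨q, rfl⟩ := hx
          obtain ⟨q', rfl⟩ := hy
          exact cosetUnit_mul_mem H _ _ _ _
        | zero_left y hy => rw [zero_mul]; exact Submodule.zero_mem _
        | zero_right x hx => rw [mul_zero]; exact Submodule.zero_mem _
        | add_left x y z _ _ _ h₁ h₂ => rw [add_mul]; exact Submodule.add_mem _ h₁ h₂
        | add_right x y z _ _ _ h₁ h₂ => rw [mul_add]; exact Submodule.add_mem _ h₁ h₂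
        | smul_left c x y _ _ h => rw [smul_mul_assoc]; exact Submodule.smul_mem _ _ h
        | smul_right c x y _ _ h => rw [mul_smul_comm]; exact Submodule.smul_mem _ _ h }
  star_mem' := by
    intro f hf
    change f ∈ Submodule.span ℂ (Set.range fun q : G × G => cosetUnit H q.1 q.2) at hf
    change star f ∈ Submodule.span ℂ (Set.range fun q : G × G => cosetUnit H q.1 q.2)
    induction hf using Submodule.span_induction with
    | mem x hx =>
      obtain ⟨q, rfl⟩ := hx
      rw [star_cosetUnit]
      exact Submodule.subset_span ⟨(q.2⁻¹ * q.1, q.2⁻¹), rfl⟩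
    | zero => rw [star_zero]; exact Submodule.zero_mem _
    | add x y _ _ h₁ h₂ => rw [star_add]; exact Submodule.add_mem _ h₁ h₂
    | smul c x _ h => rw [star_smul]; exact Submodule.smul_mem _ _ h

/-- The element `e_{rH} ⊗ δ_s`, regarded as an element of `A₀`. -/
def cosetSpanUnit (r s : G) : cosetSpan H :=
  ⟨cosetUnit H r s, Submodule.subset_span ⟨(r, s), rfl⟩⟩

/-- The canonical map from `A₀` to the crossed product `C₀(G/H) ⋊ G`. -/
def cosetSpanToCrossedProduct : cosetSpan H →⋆ₙₐ[ℂ] CosetCrossedProduct H :=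
  toEnveloping.comp (NonUnitalStarSubalgebraClass.subtype (cosetSpan H))

/-- The left action of `A₀` on `C_c(G)`: `(e_{rH} ⊗ δ_s) · ε_t = 1_{rH}(s t) ε_{s t}`. -/
def bimoduleLeft (f : cosetSpan H) (x : G →₀ ℂ) : G →₀ ℂ :=
  (ConvolutionAlgebra.coeff _ (f : CosetConvolutionAlgebra H)).sum fun s a =>
    x.sum fun t c => Finsupp.single (s * t) (a ((s * t : G) : G ⧸ H) * c)

/-- The right action of `ℂ[H]` on `C_c(G)`: `ε_t · v_s = ε_{t s}`. -/
def bimoduleRight (x : G →₀ ℂ) (b : MonoidAlgebra ℂ H) : G →₀ ℂ :=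
  x.sum fun t c => b.coeff.sum fun s d => Finsupp.single (t * (s : G)) (c * d)

/-- The `A₀`-valued form on `C_c(G)`, linear in the first variable, with
`⟨ε_s | ε_t⟩ = e_{sH} ⊗ δ_{s t⁻¹}`. -/
def bimoduleInnerLeft (x y : G →₀ ℂ) : cosetSpan H :=
  x.sum fun s c => y.sum fun t d => (c * star d) • cosetSpanUnit H s (s * t⁻¹)

open scoped Classical in
/-- The `ℂ[H]`-valued form on `C_c(G)`, linear in the second variable, with
`⟨ε_s | ε_t⟩ = v_{s⁻¹ t}` if `s⁻¹ t ∈ H` and `0` otherwise. -/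
def bimoduleInnerRight (x y : G →₀ ℂ) : MonoidAlgebra ℂ H :=
  x.sum fun s c => y.sum fun t d =>
    if h : s⁻¹ * t ∈ H then MonoidAlgebra.single (⟨s⁻¹ * t, h⟩ : H) (star c * d) else 0

end Bimodule

end

/-! Let p = e_H ⊗ δ_1, a projection in A₀. The map ε_s ↦ e_{sH} ⊗ δ_s identifies C_c(G) with the
left ideal A₀ p, and v_h ↦ e_H ⊗ δ_h identifies ℂ[H] with the corner p A₀ p. Under these
identifications both actions are multiplication in the convolution algebra, and the two forms are x
y* and x* y. All algebraic identities thus reduce to associativity and the rules for the involution.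
Since e_{rH} ⊗ δ_s = ⟨ε_r | ε_{s⁻¹r}⟩, the projection p is full, and the completion of C_c(G) is the
bimodule A p between A and p A p.

The analytic point is that p A p is the full algebra C*(H) and not a proper quotient: the embedding
of ℂ[H] must be isometric for the universal norms (`norm_toEnveloping_groupEmbed`). One inequality
is the universal property of C*(H). For the other, A needs enough representations, and the induced
one suffices: C_c(G, C₀(G/H)) acts on C_c(G) with its C*(H)-valued form. That form is positive by
Parseval's identity over the cosets (`exists_bimoduleInnerRight_eq_sum`), and the action is bounded
by `bimoduleInnerRight_convolutionLeft_add`. Its operator norm is therefore a C*-seminorm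
(`exists_cstarSeminorm_of_inner`), dominated by the norm of A. Testing on ε_1 gives the missing
inequality.

The same representation shows that A₀ embeds in A; this also uses that ℂ[H] embeds in C*(H), which
follows from the left regular representation. The pieces meet in `exists_groupCStarAlgebra_corner`,
which identifies C*(H) with p A p, and in `isImprimitivityBimodule_corner`, the general statement on
full corners. -/

noncomputable section

/-! ### Semi-inner products, C*-seminorms and maps out of enveloping algebras -/

section General

/-- The Cauchy–Schwarz inequality for a semi-inner product with values in a `C*`-algebra. It is
enough that the vectors `y ⟨y, x⟩` exist. -/
theorem norm_sq_le_of_sesquilinear_nonneg {D V : Type*} [NonUnitalCStarAlgebra D] [PartialOrder D]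
    [StarOrderedRing D] [AddCommGroup V] [Module ℂ V] (ip : V →ₗ⋆[ℂ] V →ₗ[ℂ] D)
    (hstar : ∀ x y, star (ip x y) = ip y x) (hnonneg : ∀ x, 0 ≤ ip x x)
    (hright : ∀ x y, ∃ z, ∀ w, ip w z = ip w y * ip y x) (x y : V) :
    ‖ip x y‖ ^ 2 ≤ ‖ip x x‖ * ‖ip y y‖ := by
  obtain ⟨z, hz⟩ := hright x y
  set b := ip y x with hb
  have hzl : ∀ w, ip z w = star b * ip y w := fun w => by
    rw [← hstar, hz, star_mul, hstar w y]
  have hxy : ip x y = star b := (hstar y x).symm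
  -- Here z plays the role of y⟨y, x⟩. Expanding ⟨x - cz, x - cz⟩ ≥ 0 and using b*⟨y, y⟩b ≤ ‖⟨y, y⟩‖
  -- b*b bounds a multiple of b*b by ⟨x, x⟩. The factor must be nonnegative to pass to norms.
  have key : ∀ c : ℝ, 0 ≤ 2 * c - c ^ 2 * ‖ip y y‖ →
      (2 * c - c ^ 2 * ‖ip y y‖) * ‖b‖ ^ 2 ≤ ‖ip x x‖ := by
    intro c hc
    have h1 : 0 ≤ ip x x - (2 * c) • (star b * b) + c ^ 2 • (star b * ip y y * b) := by
      have h := hnonneg (x - (c : ℂ) • z)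
      have e : ip (x - (c : ℂ) • z) (x - (c : ℂ) • z) =
          ip x x - (2 * c) • (star b * b) + c ^ 2 • (star b * ip y y * b) := by
        have exz : ip x z = star b * b := by rw [hz, hxy]
        have ezx : ip z x = star b * b := by rw [hzl]
        have ezz : ip z z = star b * ip y y * b := by rw [hzl, hz, mul_assoc]
        simp only [map_sub, LinearMap.map_smulₛₗ, LinearMap.sub_apply,
          LinearMap.smul_apply, exz, ezx, ezz, Complex.conj_ofReal, RingHom.id_apply]
        simp only [Complex.coe_smul]
        module
      rwa [e] at h
    have h2 : star b * ip y y * b ≤ ‖ip y y‖ • (star b * b) :=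
      CStarAlgebra.star_left_conjugate_le_norm_smul (hstar y y)
    have h3 : (2 * c - c ^ 2 * ‖ip y y‖) • (star b * b) ≤ ip x x := by
      have h4 : c ^ 2 • (star b * ip y y * b) ≤ c ^ 2 • (‖ip y y‖ • (star b * b)) :=
        smul_le_smul_of_nonneg_left h2 (sq_nonneg c)
      have h5 := h1.trans (add_le_add_right h4 _)
      rw [← sub_nonneg]
      convert h5 using 1
      module
    have h6 := CStarAlgebra.norm_le_norm_of_nonneg_of_le
      (smul_nonneg hc (star_mul_self_nonneg b)) h3
    rwa [norm_smul, CStarRing.norm_star_mul_self, Real.norm_of_nonneg hc, ← sq] at h6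
  rw [hxy, norm_star]
  rcases (norm_nonneg (ip y y)).eq_or_lt with h0 | h0
  · rw [← h0, mul_zero]
    by_contra hcon
    push Not at hcon
    -- If ⟨y, y⟩ = 0 the bound is linear in c; this c makes its left side ‖⟨x, x⟩‖ + 1, a
    -- contradiction.
    have h := key ((‖ip x x‖ + 1) / (2 * ‖b‖ ^ 2)) (by
      rw [← h0, mul_zero, sub_zero]; positivity)
    rw [← h0] at h
    have hb0 : ‖b‖ ≠ 0 := fun h => by simp [h] at hcon
    have : (2 * ((‖ip x x‖ + 1) / (2 * ‖b‖ ^ 2)) -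
        ((‖ip x x‖ + 1) / (2 * ‖b‖ ^ 2)) ^ 2 * 0) * ‖b‖ ^ 2 = ‖ip x x‖ + 1 := by
      rw [mul_zero, sub_zero]
      field_simp
    linarith
  -- The value c = ‖⟨y, y⟩‖⁻¹ maximises the quadratic factor.
  · have e : 2 * ‖ip y y‖⁻¹ - ‖ip y y‖⁻¹ ^ 2 * ‖ip y y‖ = ‖ip y y‖⁻¹ := by
      field_simp
      ring
    have h := key ‖ip y y‖⁻¹ (by rw [e]; positivity)
    rw [e, inv_mul_le_iff₀ h0] at h
    linarith

/-- The seminorm `‖⟨x, x⟩‖ ^ (1/2)` of a semi-inner product that satisfies the Cauchy–Schwarz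
inequality. -/
def innerSeminorm {D V : Type*} [NonUnitalCStarAlgebra D] [AddCommGroup V] [Module ℂ V]
    (ip : V →ₗ⋆[ℂ] V →ₗ[ℂ] D) (hcs : ∀ x y, ‖ip x y‖ ^ 2 ≤ ‖ip x x‖ * ‖ip y y‖) :
    Seminorm ℂ V :=
  Seminorm.of (fun x => √‖ip x x‖)
    (fun x y => by
      have h : ∀ x y, ‖ip x y‖ ≤ √‖ip x x‖ * √‖ip y y‖ := fun x y => by
        rw [← Real.sqrt_mul (norm_nonneg _)]
        exact Real.le_sqrt_of_sq_le (hcs x y)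
      refine Real.sqrt_le_iff.2 ⟨by positivity, ?_⟩
      have h1 : ip (x + y) (x + y) = ip x x + ip x y + (ip y x + ip y y) := by
        simp only [map_add, LinearMap.add_apply]
        abel
      rw [h1]
      refine (norm_add_le _ _).trans
        ((add_le_add (norm_add_le _ _) (norm_add_le _ _)).trans ?_)
      have hx := Real.mul_self_sqrt (norm_nonneg (ip x x))
      have hy := Real.mul_self_sqrt (norm_nonneg (ip y y))
      nlinarith [h x y, h y x])
    (fun c x => by
      simp only [map_smulₛₗ, LinearMap.smul_apply, norm_smul, RingHom.id_apply, RCLike.norm_conj]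
      rw [← mul_assoc, Real.sqrt_mul (by positivity), Real.sqrt_mul_self (norm_nonneg c)])

theorem innerSeminorm_apply {D V : Type*} [NonUnitalCStarAlgebra D] [AddCommGroup V] [Module ℂ V]
    (ip : V →ₗ⋆[ℂ] V →ₗ[ℂ] D) (hcs : ∀ x y, ‖ip x y‖ ^ 2 ≤ ‖ip x x‖ * ‖ip y y‖) (x : V) :
    innerSeminorm ip hcs x = √‖ip x x‖ := rfl

/-- A representation of a `*`-algebra by bounded operators on a seminormed space that behaves like
a `*`-representation on a Hilbert space gives a `C*`-seminorm, the operator norm. -/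
theorem exists_cstarSeminorm {R V : Type*} [NonUnitalRing R] [StarRing R] [Module ℂ R]
    [AddCommGroup V] [Module ℂ V] (N : Seminorm ℂ V) (act : R →ₗ[ℂ] V →ₗ[ℂ] V)
    (hmul : ∀ r s x, act (r * s) x = act r (act s x))
    (hsq : ∀ r x, N (act r x) ^ 2 ≤ N x * N (act (star r * r) x))
    (hbdd : ∀ r, ∃ M, ∀ x, N (act r x) ≤ M * N x) :
    ∃ q : CStarSeminorm R, ∀ r x, N (act r x) ≤ q r * N x := by
  -- Vectors with N x = 0 contribute 0, as division by zero gives 0. This loses nothing, because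
  -- `hbdd` forces N (act r x) = 0 for them.
  let q : R → ℝ := fun r => ⨆ x, N (act r x) / N x
  have hb : ∀ r, BddAbove (Set.range fun x => N (act r x) / N x) := by
    intro r
    obtain ⟨M, hM⟩ := hbdd r
    refine ⟨max M 0, ?_⟩
    rintro _ ⟨x, rfl⟩
    exact div_le_of_le_mul₀ (apply_nonneg N x) (le_max_right _ _) ((hM x).trans
      (mul_le_mul_of_nonneg_right (le_max_left _ _) (apply_nonneg N x)))
  have hle : ∀ r x, N (act r x) ≤ q r * N x := by
    intro r x
    rcases (apply_nonneg N x).eq_or_lt with h0 | h0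
    · obtain ⟨M, hM⟩ := hbdd r
      have := hM x
      rwa [← h0, mul_zero] at this ⊢
    · rw [← div_le_iff₀ h0]
      exact le_ciSup (hb r) x
  have hq : ∀ r M, 0 ≤ M → (∀ x, N (act r x) ≤ M * N x) → q r ≤ M := fun r M hM h =>
    ciSup_le fun x => div_le_of_le_mul₀ (apply_nonneg N x) hM (h x)
  have hq0 : ∀ r, 0 ≤ q r := fun r =>
    Real.iSup_nonneg fun x => div_nonneg (apply_nonneg N _) (apply_nonneg N _)
  have hqmul : ∀ r s, q (r * s) ≤ q r * q s := fun r s =>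
    hq _ _ (mul_nonneg (hq0 r) (hq0 s)) fun x => by
      rw [hmul, mul_assoc]
      exact (hle r _).trans (mul_le_mul_of_nonneg_left (hle s x) (hq0 r))
  have hqsq : ∀ r, q r ^ 2 ≤ q (star r * r) := fun r => by
    rw [← Real.le_sqrt (hq0 _) (hq0 _)]
    refine hq _ _ (Real.sqrt_nonneg _) fun x => ?_
    refine le_of_sq_le_sq ?_ (mul_nonneg (Real.sqrt_nonneg _) (apply_nonneg N x))
    rw [mul_pow, Real.sq_sqrt (hq0 _)]
    calc N (act r x) ^ 2 ≤ N x * N (act (star r * r) x) := hsq r x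
      _ ≤ N x * (q (star r * r) * N x) :=
        mul_le_mul_of_nonneg_left (hle _ x) (apply_nonneg N x)
      _ = _ := by ring
  -- From q(r*)² ≤ q(r r*) ≤ q(r) q(r*), cancel q(r*). Together with `hqsq` this yields the
  -- C*-identity.
  have hqstar : ∀ r, q (star r) ≤ q r := fun r => by
    rcases (hq0 (star r)).eq_or_lt with h0 | h0
    · rw [← h0]; exact hq0 r
    · have h := (hqsq (star r)).trans (hqmul _ _)
      rw [star_star, sq] at h
      exact le_of_mul_le_mul_right h h0
  refine ⟨{ Seminorm.of q
      (fun r s => hq _ _ (add_nonneg (hq0 r) (hq0 s)) fun x => by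
        rw [map_add, LinearMap.add_apply, add_mul]
        exact (map_add_le_add N _ _).trans (add_le_add (hle r x) (hle s x)))
      (fun c r => by
        simp only [q, map_smul, LinearMap.smul_apply, map_smul_eq_mul]
        rw [Real.mul_iSup_of_nonneg (norm_nonneg c)]
        simp only [mul_div_assoc]) with
      star_mul_self' := fun r => le_antisymm ?_ (hqsq r)
      mul_le' := hqmul }, hle⟩
  refine (hqmul _ _).trans ?_
  rw [sq]
  exact mul_le_mul_of_nonneg_right (hqstar r) (hq0 r)

/-- Every `C*`-seminorm is dominated by the norm of the enveloping `C*`-algebra. -/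
theorem CStarSeminorm.le_norm_toEnveloping {R : Type*} [NonUnitalRing R] [StarRing R] [Module ℂ R]
    [h : HasEnvelopingCStarAlgebra R] [StarModule ℂ R] [IsScalarTower ℂ R R] [SMulCommClass ℂ R R]
    (q : CStarSeminorm R) (r : R) :
    q r ≤ ‖(toEnveloping r : EnvelopingCStarAlgebra R)‖ := by
  rw [toEnveloping, CStarSeminorm.Completion.norm_of]
  exact le_ciSup (h.bddAbove r) q

/-- The canonical map to the enveloping `C*`-algebra has dense range. -/
theorem denseRange_toEnveloping {R : Type*} [NonUnitalRing R] [StarRing R] [Module ℂ R]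
    [HasEnvelopingCStarAlgebra R] :
    DenseRange (toEnveloping : R → EnvelopingCStarAlgebra R) :=
  (CStarSeminorm.Completion.coe_isDenseInducing (universalCStarSeminorm R)).dense

/-- The norm of a `*`-homomorphism into a `C*`-algebra, as a `C*`-seminorm. -/
def CStarSeminorm.ofHom {R A : Type*} [NonUnitalRing R] [StarRing R] [Module ℂ R]
    [NonUnitalCStarAlgebra A] (f : R →⋆ₙₐ[ℂ] A) : CStarSeminorm R :=
  { Seminorm.of (fun r => ‖f r‖) (fun r s => by rw [map_add]; exact norm_add_le _ _)
      (fun c r => by rw [map_smul, norm_smul]) with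
    star_mul_self' := fun r => by
      change ‖f (star r * r)‖ = ‖f r‖ ^ 2
      rw [map_mul, map_star, CStarRing.norm_star_mul_self, sq]
    mul_le' := fun r s => by
      change ‖f (r * s)‖ ≤ ‖f r‖ * ‖f s‖
      rw [map_mul]
      exact norm_mul_le _ _ }

/-- A `*`-homomorphism into a `C*`-algebra that attains the universal norm extends to an isometric
`*`-homomorphism of the enveloping `C*`-algebra. -/
theorem exists_isometric_extension {R A : Type*} [NonUnitalRing R] [StarRing R] [Module ℂ R]
    [HasEnvelopingCStarAlgebra R] [StarModule ℂ R] [IsScalarTower ℂ R R] [SMulCommClass ℂ R R]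
    [NonUnitalCStarAlgebra A] (f : R →⋆ₙₐ[ℂ] A)
    (hf : ∀ r, ‖f r‖ = ‖(toEnveloping r : EnvelopingCStarAlgebra R)‖) :
    ∃ F : EnvelopingCStarAlgebra R →⋆ₙₐ[ℂ] A, Isometry F ∧ ∀ r, F (toEnveloping r) = f r := by
  let P := (universalCStarSeminorm R).Pre
  have hf' : ∀ r : P, ‖f r‖ = ‖r‖ := fun r =>
    (hf r).trans (CStarSeminorm.Completion.norm_of (universalCStarSeminorm R) (r : R))
  let f₀ : P → A := fun r => f r
  have hiso : Isometry f₀ := Isometry.of_dist_eq fun r s => by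
    rw [dist_eq_norm, dist_eq_norm, ← hf' (r - s)]
    exact congrArg norm (map_sub f r s).symm
  have hF : Isometry (UniformSpace.Completion.extension f₀) := hiso.completion_extension
  let F : (universalCStarSeminorm R).Completion → A := UniformSpace.Completion.extension f₀
  have hFc : Continuous F := hF.continuous
  have hFr : ∀ r : P, F (CStarSeminorm.Completion.coe _ r) = f r := fun r =>
    UniformSpace.Completion.extension_coe hiso.uniformContinuous r
  refine ⟨{ toFun := F, map_smul' := ?_, map_zero' := ?_, map_add' := ?_, map_mul' := ?_,
            map_star' := ?_ }, hF, hFr⟩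
  · intro c x
    refine CStarSeminorm.Completion.induction_on _ x (isClosed_eq
      (hFc.comp (continuous_const_smul c)) (hFc.const_smul c)) fun a => ?_
    rw [← CStarSeminorm.Completion.coe_smul, hFr, hFr]
    exact map_smul f c a
  · exact (hFr 0).trans (map_zero f)
  · intro x y
    refine CStarSeminorm.Completion.induction_on₂ _ x y (isClosed_eq (by fun_prop)
      (by fun_prop)) fun a b => ?_
    rw [← CStarSeminorm.Completion.coe_add, hFr, hFr, hFr]
    exact map_add f a b
  · intro x y
    refine CStarSeminorm.Completion.induction_on₂ _ x y (isClosed_eq (by fun_prop)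
      (by fun_prop)) fun a b => ?_
    rw [← CStarSeminorm.Completion.coe_mul, hFr, hFr, hFr]
    exact map_mul f a b
  · intro x
    refine CStarSeminorm.Completion.induction_on _ x (isClosed_eq (by fun_prop)
      (by fun_prop)) fun a => ?_
    rw [← CStarSeminorm.Completion.coe_star, hFr, hFr]
    exact map_star f a

/-- An injective `*`-homomorphism of `C*`-algebras reflects positivity. -/
theorem NonUnitalStarAlgHom.nonneg_of_map_nonneg {A B : Type*} [NonUnitalCStarAlgebra A]
    [PartialOrder A] [StarOrderedRing A] [NonUnitalCStarAlgebra B] [PartialOrder B]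
    [StarOrderedRing B] (F : B →⋆ₙₐ[ℂ] A) (hF : Function.Injective F) {b : B}
    (hb : 0 ≤ F b) : 0 ≤ b := by
  have hsa : IsSelfAdjoint b := hF (by rw [map_star]; exact (IsSelfAdjoint.of_nonneg hb).star_eq)
  -- A *-homomorphism commutes with the functional calculus, so it carries the negative part of b to
  -- that of F b, which vanishes.
  have h1 : F (b⁻) = (F b)⁻ := by
    rw [CFC.negPart_def, CFC.negPart_def]
    exact NonUnitalStarAlgHomClass.map_cfcₙ (R := ℝ) (S := ℂ) F _ b
  have h2 : b⁻ = 0 := hF (by rw [h1, map_zero, CFC.negPart_eq_zero_iff _ (.of_nonneg hb)]; exact hb)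
  exact (CFC.negPart_eq_zero_iff b hsa).1 h2

end General

/-! ### Basis formulas and coset multipliers on C_c(G) -/

section Bimodule

variable {G : Type u} [Group G] (H : Subgroup G)

open scoped Classical in
theorem bimoduleInnerRight_single_single (s t : G) (c d : ℂ) :
    bimoduleInnerRight H (Finsupp.single s c) (Finsupp.single t d) =
      if h : s⁻¹ * t ∈ H then MonoidAlgebra.single (⟨s⁻¹ * t, h⟩ : H) (star c * d) else 0 := by
  rw [bimoduleInnerRight, Finsupp.sum_single_index (by simp), Finsupp.sum_single_index (by simp)]

/-- Pointwise multiplication of functions on `G` by a function on `G/H`. -/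
def cosetMul (c : G ⧸ H → ℂ) : (G →₀ ℂ) →ₗ[ℂ] (G →₀ ℂ) :=
  Finsupp.lsum ℂ fun t => c (t : G ⧸ H) • Finsupp.lsingle t

theorem cosetMul_single (c : G ⧸ H → ℂ) (t : G) (d : ℂ) :
    cosetMul H c (Finsupp.single t d) = c (t : G ⧸ H) • Finsupp.single t d := by
  simp [cosetMul]

end Bimodule

/-! ### C_c(G) as a left ideal and ℂ[H] as a corner of the convolution algebra -/

section Corner

variable {G : Type u} [Group G] [TopologicalSpace G] [DiscreteTopology G] (H : Subgroup G)

theorem cosetUnit_congr {r r' : G} (h : (r : G ⧸ H) = r') (s : G) :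
    cosetUnit H r s = cosetUnit H r' s := by
  rw [cosetUnit, h, cosetUnit]

theorem pointIndicator_apply {X : Type*} [TopologicalSpace X] [DiscreteTopology X]
    [DecidableEq X] (x y : X) : pointIndicator x y = if y = x then 1 else 0 := by
  change Set.indicator {x} (1 : X → ℂ) y = _
  simp [Set.indicator_apply]

theorem mul_pointIndicator {X : Type*} [TopologicalSpace X] [DiscreteTopology X] (a : C₀(X, ℂ))
    (x : X) : a * pointIndicator x = a x • pointIndicator x := by
  classical
  ext y
  simp only [ZeroAtInftyContinuousMap.mul_apply, ZeroAtInftyContinuousMap.smul_apply,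
    pointIndicator_apply, smul_eq_mul]
  split_ifs with h
  · rw [h]
  · simp

-- Translation by s moves r'H to sr'H, and the indicators of distinct points are orthogonal. The
-- units thus multiply like arrows s⁻¹rH → rH of the transformation groupoid of G acting on G/H.
open scoped Classical in
theorem cosetUnit_mul_cosetUnit (r s r' s' : G) : cosetUnit H r s * cosetUnit H r' s' =
    if (r : G ⧸ H) = ((s * r' : G) : G ⧸ H) then cosetUnit H r (s * s') else 0 := by
  rw [cosetUnit, cosetUnit, ConvolutionAlgebra.single_mul_single,
    translationAction_pointIndicator, mul_pointIndicator, pointIndicator_apply]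
  by_cases h : (r : G ⧸ H) = ((s * r' : G) : G ⧸ H)
  · rw [if_pos h.symm, if_pos h, one_smul, ← h, cosetUnit]
  · rw [if_neg (Ne.symm h), if_neg h, zero_smul, ConvolutionAlgebra.single_zero]

theorem ConvolutionAlgebra.sum_single (f : CosetConvolutionAlgebra H) :
    ((ConvolutionAlgebra.coeff _ f).sum fun s a => ConvolutionAlgebra.single _ s a) = f :=
  Finsupp.sum_single (f : G →₀ C₀(G ⧸ H, ℂ))

/-- The embedding `ε_s ↦ e_{sH} ⊗ δ_s` of `C_c(G)` as the left ideal `A₀ (e_H ⊗ δ_1)`. -/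
def cosetEmbed : (G →₀ ℂ) →ₗ[ℂ] CosetConvolutionAlgebra H :=
  Finsupp.linearCombination ℂ fun s => cosetUnit H s s

theorem cosetEmbed_apply (x : G →₀ ℂ) : cosetEmbed H x = x.sum fun s c => c • cosetUnit H s s :=
  Finsupp.linearCombination_apply ℂ x

theorem cosetEmbed_single (s : G) (c : ℂ) :
    cosetEmbed H (Finsupp.single s c) = c • cosetUnit H s s :=
  Finsupp.linearCombination_single ℂ c s

theorem coeff_cosetEmbed (x : G →₀ ℂ) (s : G) :
    ConvolutionAlgebra.coeff _ (cosetEmbed H x) s = x s • pointIndicator (s : G ⧸ H) := by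
  induction x using Finsupp.induction_linear with
  | zero => rw [map_zero, ConvolutionAlgebra.coeff_zero]; simp
  | add x y hx hy =>
    rw [map_add, ConvolutionAlgebra.coeff_add, Finsupp.add_apply, hx, hy, Finsupp.add_apply]
    exact (add_smul _ _ _).symm
  | single t c =>
    classical
    rw [cosetEmbed_single, cosetUnit, ConvolutionAlgebra.smul_single,
      ConvolutionAlgebra.coeff_single, Finsupp.single_apply, Finsupp.single_apply]
    split_ifs with h
    · rw [h]
    · rw [zero_smul]

/-- The coefficient x(s) is recovered by evaluating the image at s and then at the point sH. -/
theorem cosetEmbed_injective : Function.Injective (cosetEmbed H) := by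
  classical
  rw [injective_iff_map_eq_zero]
  intro x hx
  ext s
  have h := congrArg (fun f : C₀(G ⧸ H, ℂ) => f (s : G ⧸ H)) (coeff_cosetEmbed H x s)
  rw [hx] at h
  simpa [pointIndicator_apply, ConvolutionAlgebra.coeff_zero] using h.symm

theorem star_cosetEmbed (x : G →₀ ℂ) :
    star (cosetEmbed H x) = x.sum fun s c => star c • cosetUnit H 1 s⁻¹ := by
  rw [cosetEmbed_apply, Finsupp.sum, star_sum, Finsupp.sum]
  refine Finset.sum_congr rfl fun s _ => ?_
  rw [star_smul, star_cosetUnit, inv_mul_cancel]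

/-- The linear map underlying `groupEmbed`. -/
def groupEmbedLinear : MonoidAlgebra ℂ H →ₗ[ℂ] CosetConvolutionAlgebra H :=
  (Finsupp.linearCombination ℂ fun h : H => cosetUnit H 1 (h : G)) ∘ₗ
    (MonoidAlgebra.coeffLinearEquiv ℂ).toLinearMap

theorem groupEmbedLinear_single (h : H) (c : ℂ) :
    groupEmbedLinear H (MonoidAlgebra.single h c) = c • cosetUnit H 1 (h : G) :=
  Finsupp.linearCombination_single ℂ c h

theorem cosetUnit_one_mul (h h' : H) :
    cosetUnit H 1 (h : G) * cosetUnit H 1 (h' : G) = cosetUnit H 1 ((h * h' : H) : G) := by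
  rw [cosetUnit_mul_cosetUnit, if_pos]
  · rfl
  · rw [eq_comm, mul_one, QuotientGroup.eq, mul_one]
    exact inv_mem h.2

/-- The embedding `v_h ↦ e_H ⊗ δ_h` of `ℂ[H]` as the corner of `A₀` at the projection
`e_H ⊗ δ_1`. -/
def groupEmbed : MonoidAlgebra ℂ H →⋆ₙₐ[ℂ] CosetConvolutionAlgebra H where
  toFun := groupEmbedLinear H
  map_smul' c b := map_smul (groupEmbedLinear H) c b
  map_zero' := map_zero (groupEmbedLinear H)
  map_add' := map_add (groupEmbedLinear H)
  map_mul' a b := by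
    induction a using MonoidAlgebra.induction_linear with
    | zero => rw [zero_mul, map_zero, zero_mul]
    | add a₁ a₂ h₁ h₂ => rw [add_mul, map_add, h₁, h₂, map_add, add_mul]
    | single s c =>
      induction b using MonoidAlgebra.induction_linear with
      | zero => rw [mul_zero, map_zero, mul_zero]
      | add b₁ b₂ h₁ h₂ => rw [mul_add, map_add, h₁, h₂, map_add, mul_add]
      | single t d =>
        rw [MonoidAlgebra.single_mul_single, groupEmbedLinear_single, groupEmbedLinear_single,
          groupEmbedLinear_single, smul_mul_smul_comm, cosetUnit_one_mul]
  map_star' a := by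
    induction a using MonoidAlgebra.induction_linear with
    | zero => rw [star_zero, map_zero, star_zero]
    | add a₁ a₂ h₁ h₂ => rw [star_add, map_add, h₁, h₂, map_add, star_add]
    | single s c =>
      rw [groupAlgebra_star_single, groupEmbedLinear_single, groupEmbedLinear_single, star_smul,
        star_cosetUnit]
      congr 1
      refine cosetUnit_congr H ?_ _
      rw [QuotientGroup.eq, inv_one, one_mul, mul_one]
      exact inv_mem s.2

theorem groupEmbed_single (h : H) (c : ℂ) :
    groupEmbed H (MonoidAlgebra.single h c) = c • cosetUnit H 1 (h : G) :=
  groupEmbedLinear_single H h c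

theorem groupEmbed_apply (b : MonoidAlgebra ℂ H) :
    groupEmbed H b = b.coeff.sum fun h c => c • cosetUnit H 1 (h : G) :=
  Finsupp.linearCombination_apply ℂ b.coeff

theorem groupEmbed_injective : Function.Injective (groupEmbed H) := by
  classical
  have hc : ∀ (b : MonoidAlgebra ℂ H) (h : H), ConvolutionAlgebra.coeff _ (groupEmbed H b) (h : G) =
      b.coeff h • pointIndicator ((1 : G) : G ⧸ H) := by
    intro b h
    induction b using MonoidAlgebra.induction_linear with
    | zero => rw [map_zero, ConvolutionAlgebra.coeff_zero]; simp
    | add x y hx hy =>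
      rw [map_add, ConvolutionAlgebra.coeff_add, Finsupp.add_apply, hx, hy, MonoidAlgebra.coeff_add,
        Finsupp.add_apply]
      exact (add_smul _ _ _).symm
    | single t c =>
      rw [groupEmbed_single, cosetUnit, ConvolutionAlgebra.smul_single,
        ConvolutionAlgebra.coeff_single, MonoidAlgebra.coeff_single, Finsupp.single_apply,
        Finsupp.single_apply]
      by_cases hth : t = h
      · rw [if_pos hth, if_pos (by rw [hth])]
      · rw [if_neg hth, if_neg (fun h' => hth (Subtype.ext h')), zero_smul]
  rw [injective_iff_map_eq_zero]
  intro b hb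
  refine MonoidAlgebra.coeff_injective (Finsupp.ext fun h => ?_)
  have h := congrArg (fun f : C₀(G ⧸ H, ℂ) => f ((1 : G) : G ⧸ H)) (hc b h)
  rw [hb] at h
  simpa [pointIndicator_apply, ConvolutionAlgebra.coeff_zero] using h.symm

/-- The left action of `C_c(G, C₀(G/H))` on `C_c(G)`. -/
def convolutionLeft (f : CosetConvolutionAlgebra H) (x : G →₀ ℂ) : G →₀ ℂ :=
  (ConvolutionAlgebra.coeff _ f).sum fun s a =>
    x.sum fun t c => Finsupp.single (s * t) (a ((s * t : G) : G ⧸ H) * c)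

/-- On generators, (a ⊗ δ_s)(e_{tH} ⊗ δ_t) = a e_{stH} ⊗ δ_{st} = a(stH) e_{stH} ⊗ δ_{st}. The
action is needed for all of C_c(G, C₀(G/H)), not only for A₀, because the norm of the crossed
product is a supremum of seminorms on the larger algebra. -/
theorem cosetEmbed_convolutionLeft (f : CosetConvolutionAlgebra H) (x : G →₀ ℂ) :
    cosetEmbed H (convolutionLeft H f x) = f * cosetEmbed H x := by
  conv_rhs => rw [← ConvolutionAlgebra.sum_single H f, cosetEmbed_apply]
  rw [convolutionLeft, map_finsuppSum, Finsupp.sum_mul]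
  refine Finsupp.sum_congr fun s _ => ?_
  rw [map_finsuppSum, Finsupp.mul_sum]
  refine Finsupp.sum_congr fun t _ => ?_
  rw [cosetEmbed_single, mul_smul_comm, cosetUnit, cosetUnit, ConvolutionAlgebra.single_mul_single,
    translationAction_pointIndicator, mul_pointIndicator, ← ConvolutionAlgebra.smul_single,
    smul_smul, mul_comm]

/-- For h in H, (e_{tH} ⊗ δ_t)(e_H ⊗ δ_h) = e_{tH} ⊗ δ_{th}, and tH = thH. -/
theorem cosetEmbed_bimoduleRight (x : G →₀ ℂ) (b : MonoidAlgebra ℂ H) :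
    cosetEmbed H (bimoduleRight H x b) = cosetEmbed H x * groupEmbed H b := by
  rw [bimoduleRight, map_finsuppSum, cosetEmbed_apply, Finsupp.sum_mul]
  refine Finsupp.sum_congr fun t _ => ?_
  rw [map_finsuppSum, groupEmbed_apply, Finsupp.mul_sum]
  refine Finsupp.sum_congr fun s _ => ?_
  rw [cosetEmbed_single, smul_mul_smul_comm, cosetUnit_mul_cosetUnit, if_pos (by rw [mul_one])]
  congr 1
  refine cosetUnit_congr H ?_ _
  rw [eq_comm, QuotientGroup.eq, inv_mul_cancel_left]
  exact s.2

/-- The adjoint of e_{tH} ⊗ δ_t is e_H ⊗ δ_{t⁻¹}, and e_{sH} α_s(e_H) = e_{sH}. -/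
theorem coe_bimoduleInnerLeft (x y : G →₀ ℂ) :
    (bimoduleInnerLeft H x y : CosetConvolutionAlgebra H) =
      cosetEmbed H x * star (cosetEmbed H y) := by
  rw [bimoduleInnerLeft, star_cosetEmbed, cosetEmbed_apply, Finsupp.sum_mul]
  change (NonUnitalStarSubalgebraClass.subtype (cosetSpan H)) _ = _
  rw [map_finsuppSum]
  refine Finsupp.sum_congr fun s _ => ?_
  rw [map_finsuppSum, Finsupp.mul_sum]
  refine Finsupp.sum_congr fun t _ => ?_
  rw [map_smul, smul_mul_smul_comm, cosetUnit_mul_cosetUnit, if_pos (by rw [mul_one])]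
  rfl

/-- The product (e_H ⊗ δ_{s⁻¹})(e_{tH} ⊗ δ_t) has coefficient e_H e_{s⁻¹tH}, which is nonzero
exactly when s⁻¹t ∈ H; this is the case distinction in the form. -/
theorem groupEmbed_bimoduleInnerRight (x y : G →₀ ℂ) :
    groupEmbed H (bimoduleInnerRight H x y) = star (cosetEmbed H x) * cosetEmbed H y := by
  rw [bimoduleInnerRight, star_cosetEmbed, cosetEmbed_apply, Finsupp.sum_mul, map_finsuppSum]
  refine Finsupp.sum_congr fun s _ => ?_
  rw [map_finsuppSum, Finsupp.mul_sum]
  refine Finsupp.sum_congr fun t _ => ?_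
  rw [smul_mul_smul_comm, cosetUnit_mul_cosetUnit]
  have h : ((1 : G) : G ⧸ H) = ((s⁻¹ * t : G) : G ⧸ H) ↔ s⁻¹ * t ∈ H := by
    rw [QuotientGroup.eq, inv_one, one_mul]
  by_cases hst : s⁻¹ * t ∈ H
  · rw [dif_pos hst, if_pos (h.2 hst), groupEmbed_single]
  · rw [dif_neg hst, if_neg (fun h' => hst (h.1 h')), map_zero, smul_zero]

/-- The left action of `C_c(G, C₀(G/H))` on `C_c(G)`, as a bilinear map. -/
def convolutionLeftLinear : CosetConvolutionAlgebra H →ₗ[ℂ] (G →₀ ℂ) →ₗ[ℂ] (G →₀ ℂ) :=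
  LinearMap.mk₂ ℂ (convolutionLeft H)
    (fun f g x => cosetEmbed_injective H (by
      simp only [cosetEmbed_convolutionLeft, map_add, add_mul]))
    (fun c f x => cosetEmbed_injective H (by
      simp only [cosetEmbed_convolutionLeft, map_smul, smul_mul_assoc]))
    (fun f x y => cosetEmbed_injective H (by
      simp only [cosetEmbed_convolutionLeft, map_add, mul_add]))
    (fun c f x => cosetEmbed_injective H (by
      simp only [cosetEmbed_convolutionLeft, map_smul, mul_smul_comm]))

/-- The `ℂ[H]`-valued form on `C_c(G)`, as a sesquilinear map. -/
def bimoduleInnerRightLinear : (G →₀ ℂ) →ₗ⋆[ℂ] (G →₀ ℂ) →ₗ[ℂ] MonoidAlgebra ℂ H :=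
  LinearMap.mk₂'ₛₗ (starRingEnd ℂ) (RingHom.id ℂ) (bimoduleInnerRight H)
    (fun x y z => groupEmbed_injective H (by
      simp only [groupEmbed_bimoduleInnerRight, map_add, star_add, add_mul]))
    (fun c x y => groupEmbed_injective H (by
      simp only [groupEmbed_bimoduleInnerRight, map_smul, star_smul, smul_mul_assoc,
        starRingEnd_apply]))
    (fun x y z => groupEmbed_injective H (by
      simp only [groupEmbed_bimoduleInnerRight, map_add, mul_add]))
    (fun c x y => groupEmbed_injective H (by
      simp only [groupEmbed_bimoduleInnerRight, map_smul, mul_smul_comm, RingHom.id_apply]))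

theorem bimoduleInnerRight_star (x y : G →₀ ℂ) :
    star (bimoduleInnerRight H x y) = bimoduleInnerRight H y x :=
  groupEmbed_injective H (by
    rw [map_star, groupEmbed_bimoduleInnerRight, groupEmbed_bimoduleInnerRight, star_mul,
      star_star])

theorem bimoduleInnerRight_right (x y : G →₀ ℂ) (b : MonoidAlgebra ℂ H) :
    bimoduleInnerRight H x (bimoduleRight H y b) = bimoduleInnerRight H x y * b :=
  groupEmbed_injective H (by
    rw [map_mul, groupEmbed_bimoduleInnerRight, groupEmbed_bimoduleInnerRight,
      cosetEmbed_bimoduleRight, mul_assoc])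

theorem bimoduleInnerRight_left (f : CosetConvolutionAlgebra H) (x y : G →₀ ℂ) :
    bimoduleInnerRight H (convolutionLeft H f x) y =
      bimoduleInnerRight H x (convolutionLeft H (star f) y) :=
  groupEmbed_injective H (by
    rw [groupEmbed_bimoduleInnerRight, groupEmbed_bimoduleInnerRight, cosetEmbed_convolutionLeft,
      cosetEmbed_convolutionLeft, star_mul, mul_assoc])

theorem convolutionLeft_mul (f g : CosetConvolutionAlgebra H) (x : G →₀ ℂ) :
    convolutionLeft H (f * g) x = convolutionLeft H f (convolutionLeft H g x) :=
  cosetEmbed_injective H (by simp only [cosetEmbed_convolutionLeft, mul_assoc])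

/-- Pairing with ε_s restricts x to the coset sH and transports it to H, so pairing with coset
representatives determines x. Both Parseval's identity and definiteness rest on this. -/
theorem bimoduleInnerRight_single_left (s : G) (x : G →₀ ℂ) (h : H) :
    (bimoduleInnerRight H (Finsupp.single s 1) x).coeff h = x (s * h) := by
  classical
  change (bimoduleInnerRightLinear H (Finsupp.single s 1) x).coeff h = _
  induction x using Finsupp.induction_linear with
  | zero => rw [map_zero]; rfl
  | add x y hx hy => rw [map_add, MonoidAlgebra.coeff_add, Finsupp.add_apply, hx, hy]; rfl
  | single t c =>
    change (bimoduleInnerRight H (Finsupp.single s 1) (Finsupp.single t c)).coeff h = _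
    rw [bimoduleInnerRight, Finsupp.sum_single_index (by simp), Finsupp.sum_single_index (by simp),
      star_one, one_mul, Finsupp.single_apply]
    by_cases hst : s⁻¹ * t ∈ H
    · rw [dif_pos hst, MonoidAlgebra.coeff_single, Finsupp.single_apply]
      simp only [Subtype.ext_iff, inv_mul_eq_iff_eq_mul]
    · rw [dif_neg hst, if_neg]
      · rfl
      · rintro rfl
        exact hst (by simp)

open scoped Classical in
/-- Parseval's identity: the vectors `ε_r`, with `r` running through representatives of the cosets,
are an orthonormal basis. -/
theorem exists_bimoduleInnerRight_eq_sum (x : G →₀ ℂ) : ∃ Q : Finset (G ⧸ H), ∀ Q', Q ⊆ Q' → ∀ y,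
    bimoduleInnerRight H x y = ∑ q ∈ Q', star (bimoduleInnerRight H (Finsupp.single q.out 1) x) *
      bimoduleInnerRight H (Finsupp.single q.out 1) y := by
  induction x using Finsupp.induction_linear with
  | zero =>
    refine ⟨∅, fun Q' _ y => ?_⟩
    change bimoduleInnerRightLinear H 0 y =
      ∑ q ∈ Q', star (bimoduleInnerRightLinear H (Finsupp.single q.out 1) 0) * _
    simp
  | add x₁ x₂ h₁ h₂ =>
    obtain ⟨Q₁, h₁⟩ := h₁
    obtain ⟨Q₂, h₂⟩ := h₂
    -- Both expansions are available on any set containing the union; this is why the statement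
    -- quantifies over all larger sets.
    refine ⟨Q₁ ∪ Q₂, fun Q' hQ y => ?_⟩
    have e := congrArg₂ (· + ·) (h₁ Q' (Finset.union_subset_left hQ) y)
      (h₂ Q' (Finset.union_subset_right hQ) y)
    change bimoduleInnerRightLinear H (x₁ + x₂) y =
      ∑ q ∈ Q', star (bimoduleInnerRightLinear H (Finsupp.single q.out 1) (x₁ + x₂)) * _
    simp only [map_add, star_add, add_mul, Finset.sum_add_distrib]
    exact e
  | single s c =>
    refine ⟨{(s : G ⧸ H)}, fun Q' hQ y => ?_⟩
    rw [Finset.sum_eq_single (s : G ⧸ H)]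
    -- With r the chosen representative of sH, the factor star ⟨ε_r | ε_s⟩ = v_{s⁻¹r} changes the
    -- base point of the coset from r to s: both sides have coefficient y(sh) at h, up to the
    -- conjugate of c.
    · have hs : ((s : G ⧸ H).out)⁻¹ * s ∈ H := by
        rw [← QuotientGroup.eq, QuotientGroup.out_eq']
      refine MonoidAlgebra.coeff_injective (Finsupp.ext fun h => ?_)
      have h1 : bimoduleInnerRight H (Finsupp.single s c) y =
          star c • bimoduleInnerRight H (Finsupp.single s 1) y := by
        have : Finsupp.single s c = c • Finsupp.single s (1 : ℂ) := by simp
        rw [this]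
        exact LinearMap.map_smulₛₗ₂ (bimoduleInnerRightLinear H) _ _ _
      rw [h1, MonoidAlgebra.coeff_smul, Finsupp.smul_apply, bimoduleInnerRight_single_left,
        bimoduleInnerRight_single_single, dif_pos hs, groupAlgebra_star_single,
        MonoidAlgebra.coeff_single_mul_apply, bimoduleInnerRight_single_left]
      simp [mul_assoc]
    · intro q _ hq
      rw [bimoduleInnerRight_single_single, dif_neg, star_zero, zero_mul]
      rw [← QuotientGroup.eq, QuotientGroup.out_eq']
      exact hq
    · intro h
      exact absurd (hQ (Finset.mem_singleton_self _)) h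

theorem convolutionLeft_single_single (s : G) (a : C₀(G ⧸ H, ℂ)) (t : G) (d : ℂ) :
    convolutionLeft H (ConvolutionAlgebra.single _ s a) (Finsupp.single t d) =
      Finsupp.single (s * t) (a ((s * t : G) : G ⧸ H) * d) := by
  rw [convolutionLeft, ConvolutionAlgebra.coeff_single, Finsupp.sum_single_index (by simp),
    Finsupp.sum_single_index (by simp)]

/-- The form on ε_t, ε_r vanishes unless tH = rH, and it is invariant under left translation, since
(st)⁻¹(sr) = t⁻¹r. On a common coset the multipliers contribute only their squared moduli. With M =
‖a‖², this exhibits the defect ‖a‖²⟨x, x⟩ - ⟨fx, fx⟩, for f = a ⊗ δ_s, as another value ⟨cx, cx⟩ of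
the form. -/
theorem bimoduleInnerRight_convolutionLeft_add (s : G) (a : C₀(G ⧸ H, ℂ)) (c : G ⧸ H → ℂ) (M : ℂ)
    (hc : ∀ q, star (c q) * c q + star (a (s • q)) * a (s • q) = M) (x y : G →₀ ℂ) :
    bimoduleInnerRight H (cosetMul H c x) (cosetMul H c y) +
      bimoduleInnerRight H (convolutionLeft H (ConvolutionAlgebra.single _ s a) x)
        (convolutionLeft H (ConvolutionAlgebra.single _ s a) y) = M • bimoduleInnerRight H x y := by
  change bimoduleInnerRightLinear H _ _ + bimoduleInnerRightLinear H
    (convolutionLeftLinear H _ x) (convolutionLeftLinear H _ y) =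
    M • bimoduleInnerRightLinear H x y
  induction x using Finsupp.induction_linear with
  | zero => simp
  | add x₁ x₂ h₁ h₂ =>
    simp only [map_add, LinearMap.add_apply, smul_add, ← h₁, ← h₂]
    abel
  | single t d =>
    induction y using Finsupp.induction_linear with
    | zero => simp
    | add x₁ x₂ h₁ h₂ =>
      simp only [map_add, smul_add, ← h₁, ← h₂]
      abel
    | single r e =>
      rw [cosetMul_single, cosetMul_single]
      change bimoduleInnerRight H _ _ + bimoduleInnerRight H (convolutionLeft H _ _)
        (convolutionLeft H _ _) = M • bimoduleInnerRight H _ _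
      simp only [convolutionLeft_single_single, Finsupp.smul_single,
        bimoduleInnerRight_single_single]
      have e1 : (s * t)⁻¹ * (s * r) = t⁻¹ * r := by group
      by_cases h : t⁻¹ * r ∈ H
      · have hq : (r : G ⧸ H) = t := (QuotientGroup.eq.2 h).symm
        have hq' : ((s * r : G) : G ⧸ H) = s • (t : G ⧸ H) := by rw [← hq]; rfl
        have hq'' : ((s * t : G) : G ⧸ H) = s • (t : G ⧸ H) := rfl
        have h' : (s * t)⁻¹ * (s * r) ∈ H := by rwa [e1]
        rw [dif_pos h, dif_pos h', dif_pos h]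
        simp only [e1]
        rw [← MonoidAlgebra.single_add, MonoidAlgebra.smul_single,
          hq, hq', hq'', ← hc t]
        congr 1
        simp only [smul_eq_mul, star_mul']
        ring
      · rw [dif_neg h, dif_neg (by rwa [e1]), dif_neg h, add_zero, smul_zero]

end Corner

/-! ### Operator seminorms and the faithfulness of the left regular representation -/

section Seminorms

/-- A `*`-representation of a `*`-algebra by bounded adjointable operators on a space with a
semi-inner product with values in a `C*`-algebra gives a `C*`-seminorm, the operator norm. -/
theorem exists_cstarSeminorm_of_inner {R D V : Type*} [NonUnitalRing R] [StarRing R] [Module ℂ R]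
    [NonUnitalCStarAlgebra D] [AddCommGroup V] [Module ℂ V] (ip : V →ₗ⋆[ℂ] V →ₗ[ℂ] D)
    (hcs : ∀ x y, ‖ip x y‖ ^ 2 ≤ ‖ip x x‖ * ‖ip y y‖) (act : R →ₗ[ℂ] V →ₗ[ℂ] V)
    (hmul : ∀ r s x, act (r * s) x = act r (act s x))
    (hadj : ∀ r x y, ip (act r x) y = ip x (act (star r) y))
    (hbdd : ∀ r, ∃ M, ∀ x, innerSeminorm ip hcs (act r x) ≤ M * innerSeminorm ip hcs x) :
    ∃ q : CStarSeminorm R, ∀ r x, √‖ip (act r x) (act r x)‖ ≤ q r * √‖ip x x‖ := by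
  refine exists_cstarSeminorm (innerSeminorm ip hcs) act hmul (fun r x => ?_) hbdd
  -- By adjointability ⟨rx, rx⟩ = ⟨x, r*rx⟩, to which Cauchy–Schwarz applies.
  rw [innerSeminorm_apply, innerSeminorm_apply, innerSeminorm_apply, Real.sq_sqrt (norm_nonneg _),
    hadj, ← hmul, ← Real.sqrt_mul (norm_nonneg _)]
  exact Real.le_sqrt_of_sq_le (hcs _ _)

variable {K : Type*} [Group K]

/-- Identifies the trace form with the ℓ² inner product of coefficients, whence its positivity and
definiteness. -/
theorem groupAlgebra_coeff_star_mul (x y : MonoidAlgebra ℂ K) :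
    (star x * y).coeff 1 = x.coeff.sum fun s c => star c * y.coeff s := by
  classical
  induction x using MonoidAlgebra.induction_linear with
  | zero => simp
  | add x₁ x₂ h₁ h₂ =>
    rw [star_add, add_mul, MonoidAlgebra.coeff_add, Finsupp.add_apply, h₁, h₂,
      MonoidAlgebra.coeff_add, Finsupp.sum_add_index'] <;> simp [add_mul]
  | single s c =>
    rw [groupAlgebra_star_single, MonoidAlgebra.coeff_single_mul_apply, MonoidAlgebra.coeff_single,
      Finsupp.sum_single_index (by simp), inv_inv, mul_one]

theorem groupAlgebra_coeff_star_one (x : MonoidAlgebra ℂ K) :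
    (star x).coeff 1 = star (x.coeff 1) := by
  classical
  induction x using MonoidAlgebra.induction_linear with
  | zero => simp
  | add x₁ x₂ h₁ h₂ =>
    rw [star_add, MonoidAlgebra.coeff_add, Finsupp.add_apply, h₁, h₂,
      MonoidAlgebra.coeff_add, Finsupp.add_apply, star_add]
  | single s c =>
    rw [groupAlgebra_star_single, MonoidAlgebra.coeff_single, MonoidAlgebra.coeff_single,
      Finsupp.single_apply, Finsupp.single_apply]
    simp only [inv_eq_one]
    split_ifs <;> simp

variable (K) in
/-- The inner product `⟨x, y⟩ = (x* y) (1)` of the group algebra. -/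
def groupAlgebraInner : MonoidAlgebra ℂ K →ₗ⋆[ℂ] MonoidAlgebra ℂ K →ₗ[ℂ] ℂ :=
  LinearMap.mk₂'ₛₗ (starRingEnd ℂ) (RingHom.id ℂ) (fun x y => (star x * y).coeff 1)
    (fun x y z => by simp [add_mul]) (fun c x y => by simp)
    (fun x y z => by simp [mul_add]) (fun c x y => by simp)

theorem groupAlgebraInner_apply (x y : MonoidAlgebra ℂ K) :
    groupAlgebraInner K x y = (star x * y).coeff 1 := rfl

open scoped ComplexOrder in
theorem groupAlgebraInner_self_nonneg (x : MonoidAlgebra ℂ K) : 0 ≤ groupAlgebraInner K x x := by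
  rw [groupAlgebraInner_apply, groupAlgebra_coeff_star_mul]
  exact Finset.sum_nonneg fun s _ => star_mul_self_nonneg _

open scoped ComplexOrder in
theorem groupAlgebraInner_definite {x : MonoidAlgebra ℂ K} (h : groupAlgebraInner K x x = 0) :
    x = 0 := by
  rw [groupAlgebraInner_apply, groupAlgebra_coeff_star_mul, Finsupp.sum,
    Finset.sum_eq_zero_iff_of_nonneg fun s _ => star_mul_self_nonneg _] at h
  refine MonoidAlgebra.coeff_injective (Finsupp.ext fun s => ?_)
  by_contra hs
  have := h s (Finsupp.mem_support_iff.2 hs)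
  exact hs (by simpa using this)

open scoped ComplexOrder in
theorem groupAlgebraInner_cauchySchwarz (x y : MonoidAlgebra ℂ K) :
    ‖groupAlgebraInner K x y‖ ^ 2 ≤ ‖groupAlgebraInner K x x‖ * ‖groupAlgebraInner K y y‖ := by
  refine norm_sq_le_of_sesquilinear_nonneg (groupAlgebraInner K) (fun x y => ?_)
    groupAlgebraInner_self_nonneg (fun x y => ⟨groupAlgebraInner K y x • y, fun w => ?_⟩) x y
  · rw [groupAlgebraInner_apply, groupAlgebraInner_apply, ← groupAlgebra_coeff_star_one, star_mul,
      star_star]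
  · rw [map_smul, smul_eq_mul, mul_comm]

/-- The group algebra embeds into the full group `C*`-algebra: the left regular representation is
faithful. -/
theorem toEnveloping_groupAlgebra_injective :
    Function.Injective (toEnveloping : MonoidAlgebra ℂ K → GroupCStarAlgebra K) := by
  have hbdd : ∀ r : MonoidAlgebra ℂ K, ∃ M, ∀ x,
      innerSeminorm (groupAlgebraInner K) groupAlgebraInner_cauchySchwarz
        (LinearMap.mul ℂ (MonoidAlgebra ℂ K) r x) ≤
      M * innerSeminorm (groupAlgebraInner K) groupAlgebraInner_cauchySchwarz x := by
    intro r
    induction r using MonoidAlgebra.induction_linear with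
    | zero => exact ⟨0, fun x => by simp⟩
    | add r s hr hs =>
      obtain ⟨M, hM⟩ := hr
      obtain ⟨M', hM'⟩ := hs
      refine ⟨M + M', fun x => ?_⟩
      rw [map_add, LinearMap.add_apply, add_mul]
      exact (map_add_le_add _ _ _).trans (add_le_add (hM x) (hM' x))
    | single s c =>
      refine ⟨‖c‖, fun x => ?_⟩
      have h : MonoidAlgebra.single s c = c • MonoidAlgebra.single s (1 : ℂ) := by simp
      rw [h, map_smul, LinearMap.smul_apply, map_smul_eq_mul]
      -- Left multiplication by a group element is isometric, because v_s* v_s = 1.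
      refine mul_le_mul_of_nonneg_left (le_of_eq ?_) (norm_nonneg c)
      rw [innerSeminorm_apply, innerSeminorm_apply, groupAlgebraInner_apply,
        groupAlgebraInner_apply, LinearMap.mul_apply', star_mul, groupAlgebra_star_single,
        mul_assoc, ← mul_assoc (MonoidAlgebra.single s⁻¹ _), MonoidAlgebra.single_mul_single,
        inv_mul_cancel, star_one, one_mul, ← MonoidAlgebra.one_def, one_mul]
  obtain ⟨q, hq⟩ := exists_cstarSeminorm_of_inner (groupAlgebraInner K)
    groupAlgebraInner_cauchySchwarz (LinearMap.mul ℂ (MonoidAlgebra ℂ K))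
    (fun r s x => mul_assoc r s x)
    (fun r x y => by
      rw [groupAlgebraInner_apply, groupAlgebraInner_apply, LinearMap.mul_apply',
        LinearMap.mul_apply', star_mul, mul_assoc])
    hbdd
  refine (injective_iff_map_eq_zero (toEnveloping : _ →⋆ₙₐ[ℂ] GroupCStarAlgebra K)).2 fun r hr => ?_
  -- An element r that vanishes in C*(K) has operator seminorm 0; applied to the vector 1 this gives
  -- ⟨r, r⟩ = 0.
  have h0 : q r ≤ 0 := by
    have := q.le_norm_toEnveloping r
    rwa [hr, norm_zero] at this
  have h1 := (hq r 1).trans (mul_nonpos_of_nonpos_of_nonneg h0 (Real.sqrt_nonneg _))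
  rw [Real.sqrt_le_iff, sq, mul_zero, LinearMap.mul_apply', mul_one] at h1
  exact groupAlgebraInner_definite (norm_le_zero_iff.1 h1.2)

end Seminorms

/-! ### The induced representation on C_c(G), embeddings and density -/

section Positivity

attribute [local instance] CStarAlgebra.spectralOrder CStarAlgebra.spectralOrderedRing

variable {G : Type u} [Group G] [TopologicalSpace G] [DiscreteTopology G] (H : Subgroup G)

/-- The `ℂ[H]`-valued form on `C_c(G)`, regarded as a form with values in `C*(H)`. -/
def bimoduleInnerCStar : (G →₀ ℂ) →ₗ⋆[ℂ] (G →₀ ℂ) →ₗ[ℂ] GroupCStarAlgebra H :=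
  LinearMap.mk₂'ₛₗ (starRingEnd ℂ) (RingHom.id ℂ)
    (fun x y => toEnveloping (bimoduleInnerRightLinear H x y))
    (fun x y z => by simp) (fun c x y => by simp)
    (fun x y z => by simp) (fun c x y => by simp)

theorem bimoduleInnerCStar_apply (x y : G →₀ ℂ) :
    bimoduleInnerCStar H x y = toEnveloping (bimoduleInnerRight H x y) := rfl

/-- Parseval writes ⟨x, x⟩ as a finite sum of elements b*b with b in ℂ[H]. Positivity has to be seen
inside C*(H), since the isometric embedding into the crossed product is deduced from it. -/
theorem bimoduleInnerCStar_self_nonneg (x : G →₀ ℂ) : 0 ≤ bimoduleInnerCStar H x x := by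
  obtain ⟨Q, hQ⟩ := exists_bimoduleInnerRight_eq_sum H x
  rw [bimoduleInnerCStar_apply, hQ Q subset_rfl, map_sum]
  refine Finset.sum_nonneg fun q _ => ?_
  rw [map_mul, map_star]
  exact star_mul_self_nonneg _

/-- A vanishing sum of positive terms has vanishing terms. Once sH is among the cosets, x(s) is a
coefficient of one of the factors b, which is zero because ℂ[H] embeds in C*(H). -/
theorem bimoduleInnerCStar_definite {x : G →₀ ℂ} (h : bimoduleInnerCStar H x x = 0) : x = 0 := by
  classical
  obtain ⟨Q, hQ⟩ := exists_bimoduleInnerRight_eq_sum H x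
  ext s
  have e : (s : G ⧸ H).out * (((s : G ⧸ H).out)⁻¹ * s) = s := mul_inv_cancel_left _ _
  have hs : ((s : G ⧸ H).out)⁻¹ * s ∈ H := by rw [← QuotientGroup.eq, QuotientGroup.out_eq']
  rw [bimoduleInnerCStar_apply, hQ (insert (s : G ⧸ H) Q) (Finset.subset_insert _ _), map_sum] at h
  simp only [map_mul, map_star] at h
  rw [Finset.sum_eq_zero_iff_of_nonneg fun q _ => star_mul_self_nonneg _] at h
  have h1 := h _ (Finset.mem_insert_self _ _)
  rw [CStarRing.star_mul_self_eq_zero_iff] at h1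
  have h2 := toEnveloping_groupAlgebra_injective (h1.trans (map_zero _).symm)
  have h3 := bimoduleInnerRight_single_left H (s : G ⧸ H).out x ⟨_, hs⟩
  rw [h2] at h3
  simpa [e] using h3.symm

/-- The vector y⟨y, x⟩ already exists in C_c(G), as the form takes values in ℂ[H]; no completion is
needed. -/
theorem bimoduleInnerCStar_cauchySchwarz (x y : G →₀ ℂ) : ‖bimoduleInnerCStar H x y‖ ^ 2 ≤
    ‖bimoduleInnerCStar H x x‖ * ‖bimoduleInnerCStar H y y‖ := by
  refine norm_sq_le_of_sesquilinear_nonneg (bimoduleInnerCStar H) (fun x y => ?_)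
    (bimoduleInnerCStar_self_nonneg H)
    (fun x y => ⟨bimoduleRight H y (bimoduleInnerRight H y x), fun w => ?_⟩) x y
  · rw [bimoduleInnerCStar_apply, ← map_star, bimoduleInnerRight_star, bimoduleInnerCStar_apply]
  · simp only [bimoduleInnerCStar_apply, bimoduleInnerRight_right, map_mul]

theorem innerSeminorm_convolutionLeft_single_le (s : G) (a : C₀(G ⧸ H, ℂ)) (x : G →₀ ℂ) :
    innerSeminorm (bimoduleInnerCStar H) (bimoduleInnerCStar_cauchySchwarz H)
      (convolutionLeft H (ConvolutionAlgebra.single _ s a) x) ≤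
    ‖a‖ * innerSeminorm (bimoduleInnerCStar H) (bimoduleInnerCStar_cauchySchwarz H) x := by
  have ha : ∀ q, ‖a q‖ ≤ ‖a‖ := fun q => by
    rw [← ZeroAtInftyContinuousMap.norm_toBCF_eq_norm]
    exact a.toBCF.norm_coe_le_norm q
  -- Chosen so that |c(q)|² + |a(sq)|² = ‖a‖²; positivity of ⟨cx, cx⟩ then gives the bound. In
  -- general c does not vanish at infinity, so it is used as a bare multiplier.
  let c : G ⧸ H → ℂ := fun q => (√(‖a‖ ^ 2 - ‖a (s • q)‖ ^ 2) : ℝ)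
  have hc : ∀ q, star (c q) * c q + star (a (s • q)) * a (s • q) = ((‖a‖ ^ 2 : ℝ) : ℂ) := by
    intro q
    have h1 : star (c q) * c q = ((‖a‖ ^ 2 - ‖a (s • q)‖ ^ 2 : ℝ) : ℂ) := by
      simp only [c, Complex.star_def, Complex.conj_ofReal]
      rw [← Complex.ofReal_mul, Real.mul_self_sqrt]
      exact sub_nonneg.2 (pow_le_pow_left₀ (norm_nonneg _) (ha _) 2)
    rw [h1, Complex.star_def, Complex.conj_mul']
    push_cast
    ring
  have h := congrArg (toEnveloping : MonoidAlgebra ℂ H → GroupCStarAlgebra H)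
    (bimoduleInnerRight_convolutionLeft_add H s a c _ hc x x)
  rw [map_add, map_smul] at h
  simp only [← bimoduleInnerCStar_apply] at h
  have h2 := CStarAlgebra.norm_le_norm_of_nonneg_of_le (bimoduleInnerCStar_self_nonneg H _)
    ((le_add_of_nonneg_left (bimoduleInnerCStar_self_nonneg H _)).trans_eq h)
  rw [norm_smul, Complex.norm_real, Real.norm_of_nonneg (sq_nonneg _)] at h2
  rw [innerSeminorm_apply, innerSeminorm_apply]
  refine (Real.sqrt_le_sqrt h2).trans_eq ?_
  rw [Real.sqrt_mul (sq_nonneg _), Real.sqrt_sq (norm_nonneg _)]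

/-- The action of `C₀(G/H) ⋊ G` on `C_c(G)` is bounded for the norm of the `C*(H)`-valued
inner product. -/
theorem sqrt_norm_inner_convolutionLeft_le (f : CosetConvolutionAlgebra H) (x : G →₀ ℂ) :
    √‖bimoduleInnerCStar H (convolutionLeft H f x) (convolutionLeft H f x)‖ ≤
      ‖(toEnveloping f : CosetCrossedProduct H)‖ * √‖bimoduleInnerCStar H x x‖ := by
  have hbdd : ∀ f : CosetConvolutionAlgebra H, ∃ M, ∀ x,
      innerSeminorm (bimoduleInnerCStar H) (bimoduleInnerCStar_cauchySchwarz H)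
        (convolutionLeftLinear H f x) ≤
      M * innerSeminorm (bimoduleInnerCStar H) (bimoduleInnerCStar_cauchySchwarz H) x := by
    intro f
    induction f using ConvolutionAlgebra.induction_linear with
    | zero => exact ⟨0, fun x => by simp⟩
    | add r s hr hs =>
      obtain ⟨M, hM⟩ := hr
      obtain ⟨M', hM'⟩ := hs
      refine ⟨M + M', fun x => ?_⟩
      rw [map_add, LinearMap.add_apply, add_mul]
      exact (map_add_le_add _ _ _).trans (add_le_add (hM x) (hM' x))
    | single s a => exact ⟨‖a‖, innerSeminorm_convolutionLeft_single_le H s a⟩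
  obtain ⟨q, hq⟩ := exists_cstarSeminorm_of_inner (bimoduleInnerCStar H)
    (bimoduleInnerCStar_cauchySchwarz H) (convolutionLeftLinear H) (convolutionLeft_mul H)
    (fun r x y => congrArg toEnveloping (bimoduleInnerRight_left H r x y)) hbdd
  exact (hq f x).trans (mul_le_mul_of_nonneg_right (q.le_norm_toEnveloping f) (Real.sqrt_nonneg _))

theorem cosetEmbed_single_one : cosetEmbed H (Finsupp.single 1 1) = groupEmbed H 1 := by
  rw [cosetEmbed_single, MonoidAlgebra.one_def, groupEmbed_single]
  rfl

/-- The embedding of `ℂ[H]` as a corner of the crossed product is isometric for the universal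
norms. -/
theorem norm_toEnveloping_groupEmbed (b : MonoidAlgebra ℂ H) :
    ‖(toEnveloping (groupEmbed H b) : CosetCrossedProduct H)‖ =
      ‖(toEnveloping b : GroupCStarAlgebra H)‖ := by
  -- The upper bound is universality: the norm in the crossed product restricts to a C*-seminorm on
  -- ℂ[H].
  refine le_antisymm ((CStarSeminorm.ofHom ((toEnveloping :
    CosetConvolutionAlgebra H →⋆ₙₐ[ℂ] CosetCrossedProduct H).comp
      (groupEmbed H))).le_norm_toEnveloping b) ?_
  -- The lower bound tests the induced representation on ε_1: its image under b has inner square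
  -- b*b, and ⟨ε_1 | ε_1⟩ = 1.
  have h := sqrt_norm_inner_convolutionLeft_le H (groupEmbed H b) (Finsupp.single 1 1)
  have e1 : bimoduleInnerRight H (convolutionLeft H (groupEmbed H b) (Finsupp.single 1 1))
      (convolutionLeft H (groupEmbed H b) (Finsupp.single 1 1)) = star b * b :=
    groupEmbed_injective H (by
      rw [groupEmbed_bimoduleInnerRight, cosetEmbed_convolutionLeft, cosetEmbed_single_one,
        ← map_mul, mul_one, ← map_star, ← map_mul])
  have e2 : bimoduleInnerRight H (Finsupp.single 1 1) (Finsupp.single 1 1) = 1 :=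
    groupEmbed_injective H (by
      rw [groupEmbed_bimoduleInnerRight, cosetEmbed_single_one, ← map_star, ← map_mul, star_one,
        one_mul])
  rw [bimoduleInnerCStar_apply, bimoduleInnerCStar_apply, e1, e2, map_mul, map_star,
    CStarRing.norm_star_mul_self, Real.sqrt_mul_self (norm_nonneg _)] at h
  refine h.trans (mul_le_of_le_one_right (norm_nonneg _) (Real.sqrt_le_one.2 ?_))
  have h1 := groupAlgebra_seminorm_single_le
    (CStarSeminorm.ofHom (toEnveloping : _ →⋆ₙₐ[ℂ] GroupCStarAlgebra H)) 1 1
  rw [norm_one] at h1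
  exact h1

/-- The action on basis vectors reads off every value of f, so the left action is faithful. -/
theorem convolutionLeft_single_apply (f : CosetConvolutionAlgebra H) (s t : G) :
    convolutionLeft H f (Finsupp.single t 1) (s * t) =
      ConvolutionAlgebra.coeff _ f s ((s * t : G) : G ⧸ H) := by
  classical
  change convolutionLeftLinear H f (Finsupp.single t 1) (s * t) = _
  induction f using ConvolutionAlgebra.induction_linear with
  | zero => rw [map_zero]; rfl
  | add f g hf hg => rw [map_add, LinearMap.add_apply, Finsupp.add_apply, hf, hg]; rfl
  | single r a =>
    change convolutionLeft H _ _ _ = _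
    rw [convolutionLeft_single_single, ConvolutionAlgebra.coeff_single, Finsupp.single_apply,
      Finsupp.single_apply]
    by_cases h : r = s
    · simp [h]
    · rw [if_neg h, if_neg (fun h' => h (mul_right_cancel h'))]
      rfl

/-- `C_c(G, C₀(G/H))` embeds into the full crossed product. -/
theorem toEnveloping_cosetConvolution_injective :
    Function.Injective (toEnveloping : CosetConvolutionAlgebra H → CosetCrossedProduct H) := by
  refine (injective_iff_map_eq_zero
    (toEnveloping : _ →⋆ₙₐ[ℂ] CosetCrossedProduct H)).2 fun f hf => ?_
  have h : ∀ x, convolutionLeft H f x = 0 := fun x => by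
    have h1 := sqrt_norm_inner_convolutionLeft_le H f x
    rw [hf, norm_zero, zero_mul, Real.sqrt_le_iff, sq, mul_zero] at h1
    exact bimoduleInnerCStar_definite H (norm_le_zero_iff.1 h1.2)
  refine Finsupp.ext (f := (f : G →₀ C₀(G ⧸ H, ℂ))) fun s => ZeroAtInftyContinuousMap.ext fun q => ?_
  obtain ⟨r, rfl⟩ := QuotientGroup.mk_surjective q
  -- Taking t = s⁻¹r makes stH = rH, an arbitrary point.
  have h2 := convolutionLeft_single_apply H f s (s⁻¹ * r)
  rw [h, mul_inv_cancel_left] at h2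
  exact h2.symm

/-- The functions of finite support are dense in `C₀(X)` for discrete `X`. -/
theorem exists_norm_sub_sum_pointIndicator_le {X : Type*} [TopologicalSpace X] [DiscreteTopology X]
    (a : C₀(X, ℂ)) {ε : ℝ} (hε : 0 < ε) :
    ∃ F : Finset X, ‖a - ∑ x ∈ F, a x • pointIndicator x‖ ≤ ε := by
  classical
  have h := (Metric.tendsto_nhds.1 a.zero_at_infty' ε hε)
  -- On a discrete space compact sets are finite, so |a| ≥ ε at only finitely many points; these
  -- form the set F.
  rw [Filter.cocompact_eq_cofinite, Filter.eventually_cofinite] at h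
  refine ⟨h.toFinset, ?_⟩
  rw [← ZeroAtInftyContinuousMap.norm_toBCF_eq_norm, BoundedContinuousFunction.norm_le hε.le]
  intro y
  change ‖(a - ∑ x ∈ h.toFinset, a x • pointIndicator x) y‖ ≤ ε
  have hsum : (∑ x ∈ h.toFinset, a x • pointIndicator x : C₀(X, ℂ)) y =
      ∑ x ∈ h.toFinset, a x * (pointIndicator x : C₀(X, ℂ)) y :=
    map_sum (M := C₀(X, ℂ)) ({ toFun := fun f => f y, map_zero' := rfl,
                               map_add' := fun _ _ => rfl } : C₀(X, ℂ) →+ ℂ) _ _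
  rw [ZeroAtInftyContinuousMap.sub_apply, hsum]
  simp only [pointIndicator_apply, mul_ite, mul_one, mul_zero, Finset.sum_ite_eq]
  split_ifs with hy
  · simpa using hε.le
  · rw [Set.Finite.mem_toFinset, Set.mem_ofPred_eq, not_not, dist_zero_right] at hy
    rw [sub_zero]
    exact hy.le

/-- The map `a ↦ a ⊗ δ_s`, as an additive homomorphism. -/
def ConvolutionAlgebra.singleAddHom (s : G) : C₀(G ⧸ H, ℂ) →+ CosetConvolutionAlgebra H where
  toFun := ConvolutionAlgebra.single _ s
  map_zero' := ConvolutionAlgebra.single_zero _ s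
  map_add' := ConvolutionAlgebra.single_add _ s

/-- `A₀` is dense in the crossed product. -/
theorem denseRange_cosetSpanToCrossedProduct : DenseRange (cosetSpanToCrossedProduct H) := by
  let S := (LinearMap.range (cosetSpanToCrossedProduct H :
    cosetSpan H →ₗ[ℂ] CosetCrossedProduct H)).topologicalClosure
  have hS : ∀ f : CosetConvolutionAlgebra H, (toEnveloping f : CosetCrossedProduct H) ∈ S := by
    intro f
    induction f using ConvolutionAlgebra.induction_linear with
    | zero => rw [map_zero]; exact S.zero_mem
    | add f g hf hg => rw [map_add]; exact S.add_mem hf hg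
    | single s a =>
      refine Metric.mem_closure_iff.2 fun ε hε => ?_
      obtain ⟨F, hF⟩ := exists_norm_sub_sum_pointIndicator_le a (half_pos hε)
      refine ⟨cosetSpanToCrossedProduct H (∑ q ∈ F, a q • cosetSpanUnit H q.out s),
        ⟨_, rfl⟩, ?_⟩
      have e : cosetSpanToCrossedProduct H (∑ q ∈ F, a q • cosetSpanUnit H q.out s) =
          toEnveloping (ConvolutionAlgebra.single _ s (∑ q ∈ F, a q • pointIndicator q)) := by
        have e1 : ConvolutionAlgebra.single (translationAction G (G ⧸ H)) s
            (∑ q ∈ F, a q • pointIndicator q) = ∑ q ∈ F, a q • cosetUnit H q.out s := by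
          refine (map_sum (ConvolutionAlgebra.singleAddHom H s) _ _).trans (Finset.sum_congr rfl fun q _ => ?_)
          rw [cosetUnit, QuotientGroup.out_eq', ConvolutionAlgebra.smul_single]
          rfl
        rw [e1, map_sum, map_sum]
        refine Finset.sum_congr rfl fun q _ => ?_
        rw [map_smul, map_smul]
        rfl
      have e2 : ConvolutionAlgebra.single (translationAction G (G ⧸ H)) s a -
          ConvolutionAlgebra.single _ s (∑ q ∈ F, a q • pointIndicator q) =
          ConvolutionAlgebra.single _ s (a - ∑ q ∈ F, a q • pointIndicator q) :=
        (map_sub (ConvolutionAlgebra.singleAddHom H s) _ _).symm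
      rw [e, dist_eq_norm, ← map_sub, e2]
      refine lt_of_le_of_lt ?_ (half_lt_self hε)
      -- The map a ↦ a ⊗ δ_s is contractive for every C*-seminorm, so the approximation in C₀(G/H)
      -- carries over.
      exact (ConvolutionAlgebra.seminorm_single_le _ (CStarSeminorm.ofHom
        (toEnveloping : _ →⋆ₙₐ[ℂ] CosetCrossedProduct H)) _ _).trans hF
  have hcl : IsClosed (S : Set (CosetCrossedProduct H)) := Submodule.isClosed_topologicalClosure _
  intro x
  have : x ∈ (S : Set (CosetCrossedProduct H)) :=
    hcl.closure_subset_iff.2 (Set.range_subset_iff.2 hS) (denseRange_toEnveloping x)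
  exact this

end Positivity

/-! ### The imprimitivity bimodule A p of a full corner -/

section CornerBimodule

attribute [local instance] CStarAlgebra.spectralOrder CStarAlgebra.spectralOrderedRing

theorem isCompleteForInner_of_norm_eq {A E : Type*} [Norm A] [NormedAddCommGroup E]
    [CompleteSpace E] {ip : E → E → A} (h : ∀ z, √‖ip z z‖ = ‖z‖) : IsCompleteForInner ip := by
  intro x hx
  simp only [h, ← dist_eq_norm] at hx ⊢
  obtain ⟨y, hy⟩ := cauchySeq_tendsto_of_complete (Metric.cauchySeq_iff.2 hx)
  exact ⟨y, Metric.tendsto_atTop.1 hy⟩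

variable {A B : Type*} [NonUnitalCStarAlgebra A] [NonUnitalCStarAlgebra B]

/-- The left ideal `A p = {x | x p = x}` of an algebra, for an idempotent `p`. -/
def cornerModule (p : A) : Submodule ℂ A where
  carrier := {x | x * p = x}
  add_mem' {x y} hx hy := by
    change (x + y) * p = x + y
    rw [add_mul, hx, hy]
  zero_mem' := zero_mul p
  smul_mem' c x hx := by
    change (c • x) * p = c • x
    rw [smul_mul_assoc, hx]

/-- This is x*(a*a)x ≤ ‖a*a‖ x*x. Inside the crossed product, both boundedness axioms of the
pre-bimodule are of this kind. -/
theorem star_mul_mul_self_le (a x : A) :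
    star (a * x) * (a * x) ≤ ((‖a‖ ^ 2 : ℝ) : ℂ) • (star x * x) := by
  have h := CStarAlgebra.star_left_conjugate_le_norm_smul (a := x) (b := star a * a)
    (.star_mul_self a)
  rw [CStarRing.norm_star_mul_self, ← sq] at h
  rw [Complex.coe_smul, star_mul]
  simpa only [mul_assoc] using h

theorem mul_mul_star_self_le (a x : A) :
    x * a * star (x * a) ≤ ((‖a‖ ^ 2 : ℝ) : ℂ) • (x * star x) := by
  simpa using star_mul_mul_self_le (star a) (star x)

variable {p : A} {F : B →⋆ₙₐ[ℂ] A}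

theorem isClosed_cornerModule (p : A) : IsClosed (cornerModule p : Set A) :=
  isClosed_eq (by fun_prop) continuous_id

theorem cornerModule_mul (x : cornerModule p) : (x : A) * p = x := x.2

/-- The left action of `A` on `A p`. -/
def cornerLeft (a : A) (x : cornerModule p) : cornerModule p :=
  ⟨a * x, by change a * x * p = a * x; rw [mul_assoc, cornerModule_mul]⟩

/-- The right action on `A p` of a `C*`-algebra mapped to `p A p`. -/
def cornerRight (hF : ∀ b, F b * p = F b) (x : cornerModule p) (b : B) : cornerModule p :=
  ⟨x * F b, by change x * F b * p = x * F b; rw [mul_assoc, hF]⟩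

/-- The `A`-valued inner product `x y*` of `A p`. -/
def cornerInnerLeft (x y : cornerModule p) : A := x * star (y : A)

variable (F) in
/-- The inner product of `A p` that corresponds to `x* y` under an isomorphism `F` from `B` to
`p A p`. -/
def cornerInnerRight (x y : cornerModule p) : B := Function.invFun F (star (x : A) * y)

/-- From xp = x and yp = y it follows that x*y = p x*y p lies in the corner, hence in the range of
F, where `Function.invFun` is a genuine preimage. -/
theorem map_cornerInnerRight (hp : star p = p) (hF : ∀ y, p * y * p = y → ∃ b, F b = y)
    (x y : cornerModule p) : F (cornerInnerRight F x y) = star (x : A) * y := by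
  refine Function.invFun_eq (hF _ ?_)
  have h : p * star (x : A) = star (x : A) := by
    have h := congrArg star (cornerModule_mul x)
    rwa [star_mul, hp] at h
  rw [← mul_assoc, h, mul_assoc, cornerModule_mul]

/-- If `p` is a full projection in `A` and `B` is isomorphic to the corner `p A p`, then `A p` is
an `A`-`B` imprimitivity bimodule. -/
theorem isImprimitivityBimodule_corner (hp : star p = p) (hpp : p * p = p) (hFi : Isometry F)
    (hF' : ∀ b, F b * p = F b) (hF : ∀ y, p * y * p = y → ∃ b, F b = y)
    (hd : Dense (Submodule.span ℂ (Set.range fun q : cornerModule p × cornerModule p =>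
      cornerInnerLeft q.1 q.2) : Set A)) :
    IsImprimitivityBimodule cornerLeft (cornerRight hF') cornerInnerLeft
      (cornerInnerRight F (p := p)) := by
  have hip := map_cornerInnerRight hp hF
  have hinj := hFi.injective
  -- By the C*-identity and isometry of F, both inner product norms equal the norm of A.
  -- Completeness then follows because A p is closed.
  have hnA : ∀ x : cornerModule p, √‖cornerInnerLeft x x‖ = ‖x‖ := fun x => by
    rw [cornerInnerLeft, CStarRing.norm_self_mul_star, Real.sqrt_mul_self (norm_nonneg _)]
    rfl
  have hnB : ∀ x : cornerModule p, √‖cornerInnerRight F x x‖ = ‖x‖ := fun x => by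
    rw [← hFi.norm_map_of_map_zero (map_zero F), hip, CStarRing.norm_star_mul_self,
      Real.sqrt_mul_self (norm_nonneg _)]
    rfl
  have : CompleteSpace (cornerModule p) := (isClosed_cornerModule p).completeSpace_coe
  exact {
    left_add := fun a x y => Subtype.ext (mul_add _ _ _)
    add_left := fun a b x => Subtype.ext (add_mul _ _ _)
    left_smul := fun c a x => Subtype.ext (mul_smul_comm _ _ _)
    smul_left := fun c a x => Subtype.ext (smul_mul_assoc _ _ _)
    mul_left := fun a b x => Subtype.ext (mul_assoc _ _ _)
    add_right := fun x y b => Subtype.ext (add_mul _ _ _)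
    right_add := fun x b b' => Subtype.ext (by simp [cornerRight, mul_add])
    smul_right := fun c x b => Subtype.ext (smul_mul_assoc _ _ _)
    right_smul := fun c x b => Subtype.ext (by simp [cornerRight, mul_smul_comm])
    right_mul := fun x b b' => Subtype.ext (by simp [cornerRight, mul_assoc])
    left_right := fun a x b => Subtype.ext (mul_assoc _ _ _)
    ipA_add_left := fun x y z => add_mul _ _ _
    ipA_smul_left := fun c x y => smul_mul_assoc _ _ _
    ipA_left := fun a x y => mul_assoc _ _ _
    ipA_star := fun x y => by simp [cornerInnerLeft]
    ipA_nonneg := fun x => mul_star_self_nonneg _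
    ipA_definite := fun x hx => by
      have h := hnA x
      rw [hx, norm_zero, Real.sqrt_zero] at h
      exact norm_eq_zero.1 h.symm
    ipB_add_right := fun x y z => hinj (by simp [hip, mul_add])
    ipB_smul_right := fun c x y => hinj (by simp [hip, mul_smul_comm])
    ipB_right := fun x y b => hinj (by simp [hip, cornerRight, mul_assoc])
    ipB_star := fun x y => hinj (by rw [map_star, hip, hip, star_mul, star_star])
    ipB_nonneg := fun x => F.nonneg_of_map_nonneg hinj (by
      rw [hip]; exact star_mul_self_nonneg _)
    ipB_definite := fun x hx => by
      have h := hnB x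
      rw [hx, norm_zero, Real.sqrt_zero] at h
      exact norm_eq_zero.1 h.symm
    ipB_left := fun a x y => hinj (by simp [hip, cornerLeft, mul_assoc])
    ipA_right := fun b x y => by
      simp only [cornerInnerLeft, cornerRight, star_mul, map_star, star_star, mul_assoc]
    left_ipA := fun x y z => Subtype.ext (by
      simp [cornerLeft, cornerRight, cornerInnerLeft, hip, mul_assoc])
    dense_ipA := hd
    -- Every b is itself a value: p and F b lie in A p, and p* F b = F b.
    dense_ipB := by
      refine dense_univ.mono fun b _ => Submodule.subset_span
        ⟨(⟨p, hpp⟩, ⟨F b, hF' b⟩), hinj ?_⟩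
      have h := congrArg star (hF' (star b))
      rw [star_mul, ← map_star, star_star, hp] at h
      rw [hip, hp]
      exact h
    complete_ipA := isCompleteForInner_of_norm_eq hnA
    complete_ipB := isCompleteForInner_of_norm_eq hnB }

end CornerBimodule

/-! ### The corner C*(H) of the crossed product and the completion of C_c(G) -/

section Main

attribute [local instance] CStarAlgebra.spectralOrder CStarAlgebra.spectralOrderedRing

/-- Already c v_h = ⟨ε_1 | c ε_h⟩. -/
theorem span_bimoduleInnerRight {G : Type*} [Group G] (H : Subgroup G) : Submodule.span ℂ
    (Set.range fun q : (G →₀ ℂ) × (G →₀ ℂ) => bimoduleInnerRight H q.1 q.2) = ⊤ := by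
  refine eq_top_iff.2 fun b _ => ?_
  induction b using MonoidAlgebra.induction_linear with
  | zero => exact Submodule.zero_mem _
  | add a b ha hb => exact Submodule.add_mem _ (ha trivial) (hb trivial)
  | single h c =>
    refine Submodule.subset_span ⟨(Finsupp.single 1 1, Finsupp.single (h : G) c), ?_⟩
    have hh : (1 : G)⁻¹ * h ∈ H := by simp
    change bimoduleInnerRight H _ _ = _
    rw [bimoduleInnerRight_single_single, dif_pos hh]
    simp

variable {G : Type u} [Group G] [TopologicalSpace G] [DiscreteTopology G] (H : Subgroup G)

theorem cosetEmbed_mul_groupEmbed_one (x : G →₀ ℂ) :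
    cosetEmbed H x * groupEmbed H 1 = cosetEmbed H x := by
  rw [MonoidAlgebra.one_def, groupEmbed_single, one_smul, cosetEmbed_apply, Finsupp.sum_mul]
  refine Finsupp.sum_congr fun t _ => ?_
  rw [smul_mul_assoc, cosetUnit_mul_cosetUnit, if_pos (by rw [mul_one])]
  congr 2
  exact mul_one t

/-- Fullness of p: e_{rH} ⊗ δ_s = ⟨ε_r | ε_{s⁻¹r}⟩, as r(s⁻¹r)⁻¹ = s. -/
theorem span_bimoduleInnerLeft : Submodule.span ℂ
    (Set.range fun q : (G →₀ ℂ) × (G →₀ ℂ) => bimoduleInnerLeft H q.1 q.2) = ⊤ := by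
  refine eq_top_iff.2 fun a _ => ?_
  suffices h : ∀ f ∈ Submodule.span ℂ (Set.range fun q : G × G => cosetUnit H q.1 q.2),
      ∃ w ∈ Submodule.span ℂ
        (Set.range fun q : (G →₀ ℂ) × (G →₀ ℂ) => bimoduleInnerLeft H q.1 q.2),
        (w : CosetConvolutionAlgebra H) = f by
    obtain ⟨w, hw, hwa⟩ := h a a.2
    rwa [← Subtype.ext hwa]
  intro f hf
  induction hf using Submodule.span_induction with
  | mem f hf =>
    obtain ⟨⟨r, s⟩, rfl⟩ := hf
    refine ⟨_, Submodule.subset_span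
      ⟨(Finsupp.single r 1, Finsupp.single (s⁻¹ * r) 1), rfl⟩, ?_⟩
    have e : r * (s⁻¹ * r)⁻¹ = s := by group
    change ((bimoduleInnerLeft H _ _ : cosetSpan H) : CosetConvolutionAlgebra H) = _
    rw [coe_bimoduleInnerLeft, cosetEmbed_single, cosetEmbed_single, one_smul, one_smul,
      star_cosetUnit, inv_mul_cancel, cosetUnit_mul_cosetUnit, if_pos (by rw [mul_one]), e]
  | zero => exact ⟨0, Submodule.zero_mem _, rfl⟩
  | add f g _ _ hf hg =>
    obtain ⟨v, hv, rfl⟩ := hf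
    obtain ⟨w, hw, rfl⟩ := hg
    exact ⟨v + w, Submodule.add_mem _ hv hw, rfl⟩
  | smul c f _ hf =>
    obtain ⟨v, hv, rfl⟩ := hf
    exact ⟨c • v, Submodule.smul_mem _ c hv, rfl⟩

/-- The embedding of `C*(H)` as the corner of the crossed product at the projection
`e_H ⊗ δ_1`. -/
theorem exists_groupCStarAlgebra_corner : ∃ F : GroupCStarAlgebra H →⋆ₙₐ[ℂ] CosetCrossedProduct H,
    Isometry F ∧ (∀ b, F (toEnveloping b) = toEnveloping (groupEmbed H b)) ∧
    (∀ b, F b * toEnveloping (groupEmbed H 1) = F b) ∧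
    ∀ y, toEnveloping (groupEmbed H 1) * y * toEnveloping (groupEmbed H 1) = y → ∃ b, F b = y := by
  obtain ⟨F, hFi, hF⟩ := exists_isometric_extension
    ((toEnveloping : CosetConvolutionAlgebra H →⋆ₙₐ[ℂ] CosetCrossedProduct H).comp (groupEmbed H))
    (norm_toEnveloping_groupEmbed H)
  refine ⟨F, hFi, hF, fun b => ?_, fun y hy => ?_⟩
  · refine denseRange_toEnveloping.induction_on
      (p := fun b => F b * toEnveloping (groupEmbed H 1) = F b) b
      (isClosed_eq (hFi.continuous.mul continuous_const) hFi.continuous) fun r => ?_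
    rw [hF, NonUnitalStarAlgHom.comp_apply, ← map_mul, ← map_mul, mul_one]
  · have hcl : IsClosed (Set.range F) := hFi.isClosedEmbedding.isClosed_range
    have h : ∀ y, toEnveloping (groupEmbed H 1) * y * toEnveloping (groupEmbed H 1) ∈
        Set.range F := fun y => by
      refine (denseRange_cosetSpanToCrossedProduct H).induction_on
        (p := fun y => toEnveloping (groupEmbed H 1) * y * toEnveloping (groupEmbed H 1) ∈
          Set.range F) y (hcl.preimage (by fun_prop)) fun a => ?_
      -- For a in A₀, the compression p a p is the image of ⟨ε_1 | a ε_1⟩ in ℂ[H]. The range of an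
      -- isometry is closed, so density extends this to all of A.
      refine ⟨toEnveloping (bimoduleInnerRight H (Finsupp.single 1 1)
        (convolutionLeft H a (Finsupp.single 1 1))), ?_⟩
      rw [hF, NonUnitalStarAlgHom.comp_apply, groupEmbed_bimoduleInnerRight,
        cosetEmbed_convolutionLeft, cosetEmbed_single_one, ← map_star, star_one, ← mul_assoc,
        map_mul, map_mul]
      rfl
    obtain ⟨b, hb⟩ := h y
    exact ⟨b, hb.trans hy⟩

theorem cosetSpanToCrossedProduct_apply (a : cosetSpan H) :
    cosetSpanToCrossedProduct H a = toEnveloping (a : CosetConvolutionAlgebra H) := rfl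

theorem cosetSpanToCrossedProduct_injective : Function.Injective (cosetSpanToCrossedProduct H) :=
  (toEnveloping_cosetConvolution_injective H).comp Subtype.val_injective

/-- The map `C_c(G) → C₀(G/H) ⋊ G`, with values in the left ideal generated by `e_H ⊗ δ_1`. -/
def cosetEmbedCorner : (G →₀ ℂ) →ₗ[ℂ]
    cornerModule (toEnveloping (groupEmbed H 1) : CosetCrossedProduct H) :=
  LinearMap.codRestrict _
    ((toEnveloping : CosetConvolutionAlgebra H →⋆ₙₐ[ℂ] CosetCrossedProduct H) ∘ₗ cosetEmbed H :
      (G →₀ ℂ) →ₗ[ℂ] CosetCrossedProduct H)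
    fun x => by
      change toEnveloping (cosetEmbed H x) * toEnveloping (groupEmbed H 1) =
        toEnveloping (cosetEmbed H x)
      rw [← map_mul, cosetEmbed_mul_groupEmbed_one]

theorem coe_cosetEmbedCorner (x : G →₀ ℂ) :
    (cosetEmbedCorner H x : CosetCrossedProduct H) = toEnveloping (cosetEmbed H x) := rfl

/-- Right multiplication by p is continuous, fixes z, and sends a in A₀ to the image of a ε_1;
density of A₀ in A does the rest. -/
theorem denseRange_cosetEmbedCorner
    (z : cornerModule (toEnveloping (groupEmbed H 1) : CosetCrossedProduct H)) {ε : ℝ}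
    (hε : 0 < ε) : ∃ x, ‖(z - cosetEmbedCorner H x : CosetCrossedProduct H)‖ < ε := by
  have h : (z : CosetCrossedProduct H) * toEnveloping (groupEmbed H 1) ∈
      closure (Set.range fun x => (toEnveloping (cosetEmbed H x) : CosetCrossedProduct H)) := by
    refine (denseRange_cosetSpanToCrossedProduct H).induction_on
      (p := fun y => y * toEnveloping (groupEmbed H 1) ∈
        closure (Set.range fun x => (toEnveloping (cosetEmbed H x) : CosetCrossedProduct H)))
      (z : CosetCrossedProduct H) (isClosed_closure.preimage (by fun_prop)) fun a => ?_
    refine subset_closure ⟨convolutionLeft H a (Finsupp.single 1 1), ?_⟩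
    change toEnveloping (cosetEmbed H _) = _
    rw [cosetEmbed_convolutionLeft, cosetEmbed_single_one, map_mul]
    rfl
  rw [cornerModule_mul] at h
  obtain ⟨x, hx⟩ := Metric.mem_closure_range_iff.1 h ε hε
  exact ⟨x, by rwa [dist_eq_norm] at hx⟩

theorem isPreImprimitivityBimodule_coset :
    IsPreImprimitivityBimodule (cosetSpanToCrossedProduct H)
      (toEnveloping : MonoidAlgebra ℂ H →⋆ₙₐ[ℂ] GroupCStarAlgebra H)
      (bimoduleLeft H) (bimoduleRight H) (bimoduleInnerLeft H) (bimoduleInnerRight H) := by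
  obtain ⟨F, hFi, hF, -, -⟩ := exists_groupCStarAlgebra_corner H
  have hj := cosetEmbed_injective H
  have hφ := groupEmbed_injective H
  have hc : Function.Injective (Subtype.val : cosetSpan H → CosetConvolutionAlgebra H) :=
    Subtype.val_injective
  have hla : ∀ (a : cosetSpan H) x,
      cosetEmbed H (bimoduleLeft H a x) = (a : CosetConvolutionAlgebra H) * cosetEmbed H x :=
    fun a x => cosetEmbed_convolutionLeft H a x
  have hra := cosetEmbed_bimoduleRight H
  have hA := coe_bimoduleInnerLeft H
  have hB := groupEmbed_bimoduleInnerRight H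
  have hmul : ∀ a b : cosetSpan H, ((a * b : cosetSpan H) : CosetConvolutionAlgebra H) = a * b :=
    fun _ _ => rfl
  have hadd : ∀ a b : cosetSpan H, ((a + b : cosetSpan H) : CosetConvolutionAlgebra H) = a + b :=
    fun _ _ => rfl
  have hsmul : ∀ (c : ℂ) (a : cosetSpan H),
      ((c • a : cosetSpan H) : CosetConvolutionAlgebra H) = c • a := fun _ _ => rfl
  have hstar : ∀ a : cosetSpan H, ((star a : cosetSpan H) : CosetConvolutionAlgebra H) =
      star (a : CosetConvolutionAlgebra H) :=
    fun _ => rfl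
  have hιA : ∀ x, cosetSpanToCrossedProduct H (bimoduleInnerLeft H x x) =
      toEnveloping (cosetEmbed H x) * star (toEnveloping (cosetEmbed H x)) := fun x => by
    rw [cosetSpanToCrossedProduct_apply, hA, map_mul, map_star]
  have hιB : ∀ x, F (toEnveloping (bimoduleInnerRight H x x)) =
      star (toEnveloping (cosetEmbed H x)) * toEnveloping (cosetEmbed H x) := fun x => by
    rw [hF, hB, map_mul, map_star]
  exact {
    left_add := fun a x y => hj (by simp only [hla, map_add, mul_add])
    add_left := fun a b x => hj (by simp only [hla, map_add, hadd, add_mul])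
    left_smul := fun c a x => hj (by simp only [hla, map_smul, mul_smul_comm])
    smul_left := fun c a x => hj (by simp only [hla, map_smul, hsmul, smul_mul_assoc])
    mul_left := fun a b x => hj (by simp only [hla, hmul, mul_assoc])
    add_right := fun x y b => hj (by simp only [hra, map_add, add_mul])
    right_add := fun x b b' => hj (by simp only [hra, map_add, mul_add])
    smul_right := fun c x b => hj (by simp only [hra, map_smul, smul_mul_assoc])
    right_smul := fun c x b => hj (by simp only [hra, map_smul, mul_smul_comm])
    right_mul := fun x b b' => hj (by simp only [hra, map_mul, mul_assoc])
    left_right := fun a x b => hj (by simp only [hla, hra, mul_assoc])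
    injective_ιA := cosetSpanToCrossedProduct_injective H
    injective_ιB := toEnveloping_groupAlgebra_injective
    denseRange_ιA := denseRange_cosetSpanToCrossedProduct H
    denseRange_ιB := denseRange_toEnveloping
    ipA_add_left := fun x y z => hc (by simp only [hA, map_add, hadd, add_mul])
    ipA_smul_left := fun c x y => hc (by simp only [hA, map_smul, hsmul, smul_mul_assoc])
    ipA_left := fun a x y => hc (by simp only [hA, hla, hmul, mul_assoc])
    ipA_star := fun x y => hc ((hstar _).trans (by rw [hA, hA, star_mul, star_star]))
    ipA_nonneg := fun x => by
      rw [hιA]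
      exact mul_star_self_nonneg _
    ipB_add_right := fun x y z => hφ (by simp only [hB, map_add, mul_add])
    ipB_smul_right := fun c x y => hφ (by simp only [hB, map_smul, mul_smul_comm])
    ipB_right := fun x y b => bimoduleInnerRight_right H x y b
    ipB_star := fun x y => bimoduleInnerRight_star H x y
    ipB_nonneg := fun x => bimoduleInnerCStar_self_nonneg H x
    ipB_left := fun a x y => bimoduleInnerRight_left H a x y
    ipA_right := fun b x y => hc (by simp only [hA, hra, map_star, star_mul, star_star, mul_assoc])
    left_ipA := fun x y z => hj (by simp only [hla, hra, hA, hB, mul_assoc])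
    -- The inequality in C*(H) is tested in the crossed product, since the injective F reflects
    -- positivity.
    ipB_bounded := fun a x => by
      rw [← sub_nonneg]
      refine F.nonneg_of_map_nonneg hFi.injective ?_
      rw [map_sub, map_smul, hιB, hιB, hla, map_mul, sub_nonneg]
      exact star_mul_mul_self_le _ _
    -- Isometry of the corner embedding is essential: it replaces ‖b‖ in C*(H) by the norm of its
    -- image in A.
    ipA_bounded := fun b x => by
      rw [hιA, hιA, hra, map_mul, ← norm_toEnveloping_groupEmbed]
      exact mul_mul_star_self_le _ _
    dense_ipA := by
      rw [span_bimoduleInnerLeft, Submodule.top_coe, Set.image_univ]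
      exact denseRange_cosetSpanToCrossedProduct H
    dense_ipB := by
      rw [span_bimoduleInnerRight, Submodule.top_coe, Set.image_univ]
      exact denseRange_toEnveloping }

/-- The completion is realised concretely as the closed left ideal A p, so no abstract completion of
C_c(G) is formed. -/
theorem exists_imprimitivityBimodule_completion :
    ∃ (E : Type u) (_ : AddCommGroup E) (_ : Module ℂ E)
      (la : CosetCrossedProduct H → E → E) (ra : E → GroupCStarAlgebra H → E)
      (ipA : E → E → CosetCrossedProduct H) (ipB : E → E → GroupCStarAlgebra H)
      (j : (G →₀ ℂ) →ₗ[ℂ] E),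
      IsImprimitivityBimodule la ra ipA ipB ∧
      IsBimoduleCompletion (cosetSpanToCrossedProduct H)
        (toEnveloping : MonoidAlgebra ℂ H →⋆ₙₐ[ℂ] GroupCStarAlgebra H)
        (bimoduleLeft H) (bimoduleRight H) (bimoduleInnerLeft H) (bimoduleInnerRight H)
        la ra ipA ipB j := by
  obtain ⟨F, hFi, hF, hF', hFr⟩ := exists_groupCStarAlgebra_corner H
  have hp : star (toEnveloping (groupEmbed H 1) : CosetCrossedProduct H) =
      toEnveloping (groupEmbed H 1) := by
    rw [← map_star, ← map_star, star_one]
  have hpp : (toEnveloping (groupEmbed H 1) : CosetCrossedProduct H) *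
      toEnveloping (groupEmbed H 1) = toEnveloping (groupEmbed H 1) := by
    rw [← map_mul, ← map_mul, one_mul]
  have hip := map_cornerInnerRight hp hFr
  have hA : ∀ x y, cornerInnerLeft (cosetEmbedCorner H x) (cosetEmbedCorner H y) =
      cosetSpanToCrossedProduct H (bimoduleInnerLeft H x y) := fun x y => by
    rw [cornerInnerLeft, coe_cosetEmbedCorner, coe_cosetEmbedCorner,
      cosetSpanToCrossedProduct_apply, coe_bimoduleInnerLeft, map_mul, map_star]
  have hd : Dense (Submodule.span ℂ (Set.range fun q :
      cornerModule (toEnveloping (groupEmbed H 1) : CosetCrossedProduct H) ×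
      cornerModule (toEnveloping (groupEmbed H 1) : CosetCrossedProduct H) =>
      cornerInnerLeft q.1 q.2) : Set (CosetCrossedProduct H)) := by
    -- Values of the form on A p include those on C_c(G), whose span is already dense in A.
    refine (isPreImprimitivityBimodule_coset H).dense_ipA.mono ?_
    rintro _ ⟨a, ha, rfl⟩
    have h := Submodule.mem_map_of_mem (f := (cosetSpanToCrossedProduct H :
      cosetSpan H →ₗ[ℂ] CosetCrossedProduct H)) ha
    rw [Submodule.map_span] at h
    refine Submodule.span_mono ?_ h
    rintro _ ⟨_, ⟨q, rfl⟩, rfl⟩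
    exact ⟨(cosetEmbedCorner H q.1, cosetEmbedCorner H q.2), hA q.1 q.2⟩
  refine ⟨cornerModule (toEnveloping (groupEmbed H 1) : CosetCrossedProduct H), inferInstance,
    inferInstance, cornerLeft, cornerRight hF', cornerInnerLeft, cornerInnerRight F,
    cosetEmbedCorner H, isImprimitivityBimodule_corner hp hpp hFi hF' hFr hd, ?_⟩
  exact {
    map_left := fun a x => Subtype.ext (by
      change toEnveloping (cosetEmbed H (convolutionLeft H a x)) = _ * toEnveloping _
      rw [cosetEmbed_convolutionLeft, map_mul]
      rfl)
    map_right := fun x b => Subtype.ext (by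
      change toEnveloping (cosetEmbed H (bimoduleRight H x b)) = toEnveloping _ * F _
      rw [cosetEmbed_bimoduleRight, map_mul, hF])
    map_ipA := hA
    map_ipB := fun x y => hFi.injective (by
      rw [hip, hF, groupEmbed_bimoduleInnerRight, map_mul, map_star]
      rfl)
    dense_ipA := fun z ε hε => by
      obtain ⟨x, hx⟩ := denseRange_cosetEmbedCorner H z hε
      refine ⟨x, ?_⟩
      rwa [cornerInnerLeft, CStarRing.norm_self_mul_star, Real.sqrt_mul_self (norm_nonneg _)]
    dense_ipB := fun z ε hε => by
      obtain ⟨x, hx⟩ := denseRange_cosetEmbedCorner H z hε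
      refine ⟨x, ?_⟩
      rwa [← hFi.norm_map_of_map_zero (map_zero F), hip, CStarRing.norm_star_mul_self,
        Real.sqrt_mul_self (norm_nonneg _)] }

end Main

end

theorem mainTheorem7 {G : Type u} [Group G] [Countable G] [TopologicalSpace G]
    [DiscreteTopology G] (H : Subgroup G) :
    MoritaEquivalent (CosetCrossedProduct H) (GroupCStarAlgebra H) ∧
    IsPreImprimitivityBimodule (cosetSpanToCrossedProduct H)
      (toEnveloping : MonoidAlgebra ℂ H →⋆ₙₐ[ℂ] GroupCStarAlgebra H)
      (bimoduleLeft H) (bimoduleRight H) (bimoduleInnerLeft H) (bimoduleInnerRight H) ∧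
    ∃ (E : Type u) (_ : AddCommGroup E) (_ : Module ℂ E)
      (la : CosetCrossedProduct H → E → E) (ra : E → GroupCStarAlgebra H → E)
      (ipA : E → E → CosetCrossedProduct H) (ipB : E → E → GroupCStarAlgebra H)
      (j : (G →₀ ℂ) →ₗ[ℂ] E),
      IsImprimitivityBimodule la ra ipA ipB ∧
      IsBimoduleCompletion (cosetSpanToCrossedProduct H)
        (toEnveloping : MonoidAlgebra ℂ H →⋆ₙₐ[ℂ] GroupCStarAlgebra H)
        (bimoduleLeft H) (bimoduleRight H) (bimoduleInnerLeft H) (bimoduleInnerRight H)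
        la ra ipA ipB j := by
  obtain ⟨E, _, _, la, ra, ipA, ipB, j, h, hj⟩ := exists_imprimitivityBimodule_completion H
  exact ⟨⟨E, _, _, la, ra, ipA, ipB, h⟩, isPreImprimitivityBimodule_coset H,
    E, _, _, la, ra, ipA, ipB, j, h, hj⟩
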